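/- Consider the following four cases, with $r,a>0$ and $\mathrm{i}=\sqrt{-1}$: (I) rational, $s(x)=x$, $\rho=0$; (II) trigonometric, $s(x)=\frac1r\sin(rx)$, $\rho=1$, $\omega_1=\pi/r$; (III) hyperbolic, $s(x)=\frac a\pi\sinh(\pi x/a)$, $\rho=1$, $\omega_1=\mathrm{i}a$; (IV) elliptic, $s(x)=\frac1r e^{ra/4}\vartheta_1(rx\,|\,\mathrm{i}ra/\pi)$, $\rho=3$, $\omega_1=\pi/r$, $\omega_2=\mathrm{i}a$, $\omega_3=-\omega_1-\omega_2$, where $\vartheta_1(z|\tau)=2e^{\mathrm{i}\pi\tau/4}\sin z\prod_{n\ge1}(1-e^{2\pi\mathrm{i}n\tau})(1-2e^{2\pi\mathrm{i}n\tau}\cos 2z+e^{4\pi\mathrm{i}n\tau})$. In all cases put $\omega_0=0$, $\Omega=\sum_\nu\mathbb Z\omega_\nu$, $|\omega|=\sum_{\nu=0}^{\rho}\omega_\nu$, $(\xi_0,\xi_1,\xi_2,\xi_3)=(0,0,-1,1)$. For $\alpha>0$ the Gamma function $G(x;\alpha)$ is (I) $\Gamma(\frac12+\frac{x}{\mathrm{i}\alpha})$;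 (II) $e^{-rx^2/2\alpha}\prod_{n\ge1}(1-e^{-r\alpha(2n-1)}e^{2\mathrm{i}rx})^{-1}$; (III) $G_{\mathrm R}(x-\mathrm{i}a/2)$, where $G_{\mathrm R}$ is the meromorphic continuation of $\exp\bigl(\mathrm{i}\int_0^\infty\frac{dy}{y}\bigl(\frac{\sin 2xy}{2\sinh(ay)\sinh(\alpha y)}-\frac{x}{a\alpha y}\bigr)\bigr)$, $|\mathrm{Im}\,x|<(a+\alpha)/2$; (IV) $e^{-rx^2/2\alpha}G_{\mathrm R}(x-\mathrm{i}a/2)$, where $G_{\mathrm R}(x)=\prod_{n,m\ge1}\frac{1-e^{-ra(2n-1)}e^{-r\alpha(2m-1)}e^{-2\mathrm{i}rx}}{1-e^{-ra(2n-1)}e^{-r\alpha(2m-1)}e^{2\mathrm{i}rx}}$; or, more generally, in each case any meromorphic function $G(\cdot\,;\alpha)$ such that $G(x+\mathrm{i}\alpha/2;\alpha)=\kappa\,s(x)\,G(x-\mathrm{i}\alpha/2;\alpha)$ for some constant $\kappa\neq0$. Let $N\ge0$ be an integer, $g=(g_0,\dots,g_{2\rho+1})\in\mathbb R^{2\rho+2}$,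 $|g|=\sum_\nu g_\nu$, $\lambda\in\mathbb R$ and $\beta>0$. Assume that no nonzero integer multiple of $\mathrm{i}\beta$ lies in $\Omega$, and that $s(\frac12(\omega_\nu-\omega_\mu+\mathrm{i}(\lambda-1)\beta))\ne0$ for all $0\le\mu,\nu\le\rho$ (so that $V^0$ and $c^0$ below are defined). For $x\in\mathbb C^N$ let $$V_j^{\pm}(x)=\frac{\prod_{\nu=0}^{2\rho+1}s(\pm x_j-\mathrm{i}g_\nu\beta)}{s(\pm2x_j)\,s(\pm2x_j-\mathrm{i}\beta)}\prod_{\delta=\pm}\prod_{k\ne j}\frac{s(x_j+\delta x_k\mp\mathrm{i}\lambda\beta)}{s(x_j+\delta x_k)},$$ $$V^0(x)=-\frac{\prod_{\nu=1}^{\rho}s(\frac{\omega_\nu}2)^2}4\sum_{\nu=0}^{\rho}\frac{e^{-r\xi_\nu(2\lambda N+|g|-\frac12(\rho+1)(\lambda+1))\beta}}{\prod_{\mu\ne\nu}s(\frac12(\omega_\nu-\omega_\mu))}\,\frac{\prod_{\mu=0}^{2\rho+1}s(\frac{\omega_\nu}2+\frac{\mathrm{i}\beta}2-\mathrm{i}g_\mu\beta)}{\prod_{\mu=0}^{\rho}s(\frac12(\omega_\nu-\omega_\mu+\mathrm{i}(1-\lambda)\beta))}\prod_{\delta=\pm}\prod_{j=1}^N\frac{s(\delta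 x_j+\frac{\omega_\nu}2+\frac{\mathrm{i}\beta}2-\mathrm{i}\lambda\beta)}{s(\delta x_j+\frac{\omega_\nu}2+\frac{\mathrm{i}\beta}2)},$$ $$c^0=\frac{\prod_{\nu=1}^{\rho}s(\frac{\omega_\nu}2)^2}4\sum_{\nu=0}^{\rho}\frac{e^{-r\xi_\nu(|g|-\frac12(\rho+1)(\lambda+1))\beta}}{\prod_{\mu\ne\nu}s(\frac12(\omega_\nu-\omega_\mu))}\,\frac{\prod_{\mu=0}^{2\rho+1}s(\frac{\omega_\nu}2+\frac{\mathrm{i}\lambda\beta}2-\mathrm{i}g_\mu\beta)}{\prod_{\mu=0}^{\rho}s(\frac12(\omega_\nu-\omega_\mu+\mathrm{i}(\lambda-1)\beta))}$$ (in cases I–III all $\xi_\nu$ that occur are $0$), and let the Koornwinder–van Diejen operator be $$H_N=s(\mathrm{i}\lambda\beta)\sum_{\varepsilon=\pm}\sum_{j=1}^N (V_j^{\varepsilon})^{1/2}\,e^{-\varepsilon\mathrm{i}\beta\,\partial/\partial x_j}\,(V_j^{-\varepsilon})^{1/2}+V^0 ,\qquad (e^{-\varepsilon\mathrm{i}\beta\,\partial/\partial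 x_j}f)(x)=f(x-\varepsilon\mathrm{i}\beta e_j).$$ Let $$\Psi_N(x)=\prod_{j=1}^N\Bigl(\frac{G(2x_j+\frac{\mathrm{i}\beta}2;\beta)\,G(-2x_j+\frac{\mathrm{i}\beta}2;\beta)}{\prod_{\nu=0}^{2\rho+1}G(x_j+\frac{\mathrm{i}\beta}2-\mathrm{i}g_\nu\beta;\beta)\,G(-x_j+\frac{\mathrm{i}\beta}2-\mathrm{i}g_\nu\beta;\beta)}\Bigr)^{1/2}\prod_{j<k}\prod_{\varepsilon,\varepsilon'=\pm}\Bigl(\frac{G(\varepsilon x_j+\varepsilon'x_k+\frac{\mathrm{i}\beta}2;\beta)}{G(\varepsilon x_j+\varepsilon'x_k-\mathrm{i}\lambda\beta+\frac{\mathrm{i}\beta}2;\beta)}\Bigr)^{1/2}.$$ In case IV assume moreover that $2\lambda(N-1)+\sum_{\nu=0}^7g_\nu-2=0$; in cases I–III the parameters are otherwise arbitrary. Call a point regular if no $s$-factor $s(2x_j)$, $s(2x_j\pm\mathrm{i}\beta)$, $s(x_j\pm x_k)$ ($k\neq j$) vanishes there and no $G$-factor of $\Psi_N$ has a zero or pole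 there. Then, for every choice of a branch of the square root $\Psi_N$ and of branches of $(V_j^{+})^{1/2}$, there are branches of $(V_j^{-})^{1/2}$ (holomorphic at every $y$ such that all points near $y$ and near $y+\mathrm{i}\beta e_j$ are regular, $\Psi_N$ is holomorphic at $y$ and at $y+\mathrm{i}\beta e_j$, and $(V_j^+)^{1/2}$ is holomorphic at $y+\mathrm{i}\beta e_j$) such that, at all $x$ for which $x$ and all $x\pm\mathrm{i}\beta e_j$ are regular, $$(H_N\Psi_N)(x)=\mathcal E_N\,\Psi_N(x),\qquad \mathcal E_N=c^0+\frac{\prod_{\nu=1}^{\rho}s(\frac{\omega_\nu}2)^2}4\;s\Bigl(\mathrm{i}\beta\bigl[2\lambda N+|g|-\tfrac12(\rho+1)(\lambda+1)\bigr]-|\omega|\Bigr).$$ -/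

import Mathlib

open Complex

noncomputable section

namespace VanDiejen

/-- The four cases: rational (I), trigonometric (II) with scale `r`, hyperbolic (III) with
scale `a`, elliptic (IV) with scales `r` and `a`. -/
inductive SCase where
  | rational : SCase
  | trigonometric (r : ℝ) : SCase
  | hyperbolic (a : ℝ) : SCase
  | elliptic (r a : ℝ) : SCase

/-- The scale parameters are positive. -/
def SCase.Positive : SCase → Prop
  | .rational => True
  | .trigonometric r => 0 < r
  | .hyperbolic a => 0 < a
  | .elliptic r a => 0 < r ∧ 0 < a

/-- The odd Jacobi theta function `ϑ₁(z | τ)`, by its product representation. -/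
def theta1 (z τ : ℂ) : ℂ :=
  2 * exp (I * Real.pi * τ / 4) * sin z *
    ∏' n : ℕ, ((1 - exp (2 * I * Real.pi * (n + 1) * τ)) *
      (1 - 2 * exp (2 * I * Real.pi * (n + 1) * τ) * cos (2 * z)
        + exp (4 * I * Real.pi * (n + 1) * τ)))

/-- The function `s(x)`. -/
def SCase.s : SCase → ℂ → ℂ
  | .rational, x => x
  | .trigonometric r, x => (1 / r) * sin (r * x)
  | .hyperbolic a, x => (a / Real.pi) * sinh (Real.pi * x / a)
  | .elliptic r a, x => (1 / r) * exp (r * a / 4) * theta1 (r * x) (I * r * a / Real.pi)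

/-- The number `ρ`. -/
def SCase.rho : SCase → ℕ
  | .rational => 0
  | .trigonometric _ => 1
  | .hyperbolic _ => 1
  | .elliptic _ _ => 3

/-- The numbers `ω_ν`; only the values at `ν ≤ ρ` are ever used. -/
def SCase.omega : SCase → ℕ → ℂ
  | .trigonometric r, 1 => Real.pi / r
  | .hyperbolic a, 1 => I * a
  | .elliptic r _, 1 => Real.pi / r
  | .elliptic _ a, 2 => I * a
  | .elliptic r a, 3 => -(Real.pi / r) - I * a
  | _, _ => 0

/-- The products `r ξ_ν`, where `(ξ₀, ξ₁, ξ₂, ξ₃) = (0, 0, -1, 1)`; as `ξ₀ = ξ₁ = 0`, they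
vanish in the rational, trigonometric and hyperbolic cases. -/
def SCase.rXi : SCase → ℕ → ℝ
  | .elliptic r _, 2 => -r
  | .elliptic r _, 3 => r
  | _, _ => 0

/-- The additive group `Ω` generated by `ω₀, …, ω_ρ`. -/
def SCase.Omega (c : SCase) : AddSubgroup ℂ :=
  AddSubgroup.closure (c.omega '' {ν | ν ≤ c.rho})

/-- `|ω| = ω₀ + ⋯ + ω_ρ`. -/
def SCase.omegaSum (c : SCase) : ℂ := ∑ ν ∈ Finset.range (c.rho + 1), c.omega ν

/-- `(1/4) ∏_{ν=1}^ρ s(ω_ν/2)²`. -/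
def SCase.prefactor (c : SCase) : ℂ :=
  (∏ ν ∈ Finset.Icc 1 c.rho, c.s (c.omega ν / 2) ^ 2) / 4

/-! ### Gamma functions

`G(x; α)` for real `α > 0`. At poles the value is `0`, as it is at zeros. -/

/-- Trigonometric `G_R(r, α; x)`. -/
def trigG (r α : ℝ) (x : ℂ) : ℂ :=
  ∏' n : ℕ, (1 - exp (-(r * α * (2 * (n + 1) - 1))) * exp (2 * I * r * x))⁻¹

/-- Hyperbolic `G_R(a, α; x)` by its integral representation, which converges in the strip
`|Im x| < (a + α)/2`. -/
def hypGStrip (a α : ℝ) (x : ℂ) : ℂ :=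
  exp (I * ∫ y in Set.Ioi (0 : ℝ),
    (1 / (y : ℂ)) * (sin (2 * x * y) / (2 * sinh (a * y) * sinh (α * y)) - x / (a * α * y)))

/-- Hyperbolic `G_R(a, α; x)` on all of `ℂ`: the meromorphic continuation of the integral from
the strip `|Im x| ≤ α/2`, by means of the equation
`G_R(x + iα/2) = 2 cosh(πx/a) G_R(x - iα/2)` that it satisfies.
Here `x = x₀ + i n α` with `n` an integer and `|Im x₀| ≤ α/2`. -/
def hypG (a α : ℝ) (x : ℂ) : ℂ :=
  let n : ℤ := round (x.im / α)
  let x₀ : ℂ := x - I * n * α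
  hypGStrip a α x₀ *
    (∏ k ∈ Finset.range n.toNat, 2 * cosh (Real.pi * (x₀ + I * α * (k + 1 / 2)) / a)) /
    (∏ k ∈ Finset.range (-n).toNat, 2 * cosh (Real.pi * (x₀ - I * α * (k + 1 / 2)) / a))

/-- Elliptic `G_R(r, a, α; x)`. -/
def ellG (r a α : ℝ) (x : ℂ) : ℂ :=
  ∏' p : ℕ × ℕ,
    ((1 - exp (-(r * a * (2 * (p.1 + 1) - 1))) * exp (-(r * α * (2 * (p.2 + 1) - 1))) *
        exp (-(2 * I * r * x))) /
      (1 - exp (-(r * a * (2 * (p.1 + 1) - 1))) * exp (-(r * α * (2 * (p.2 + 1) - 1))) *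
        exp (2 * I * r * x)))

/-- The Gamma function `G(x; α)`, `α > 0`, in each of the four cases. -/
def SCase.G : SCase → ℝ → ℂ → ℂ
  | .rational, α, x => Gamma (1 / 2 + x / (I * α))
  | .trigonometric r, α, x => exp (-(r * x ^ 2 / (2 * α))) * trigG r α x
  | .hyperbolic a, α, x => hypG a α (x - I * a / 2)
  | .elliptic r a, α, x => exp (-(r * x ^ 2 / (2 * α))) * ellG r a α (x - I * a / 2)

/-- `G` is a meromorphic function (normalized to have the value `0` at its poles) that solves
`G(x + iα/2) / G(x - iα/2) = κ s(x)` for some constant `κ ≠ 0`. -/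
def SCase.IsGammaFunction (c : SCase) (α : ℝ) (G : ℂ → ℂ) : Prop :=
  MeromorphicNFOn G Set.univ ∧
    ∃ κ : ℂ, κ ≠ 0 ∧ ∀ x : ℂ, c.s x ≠ 0 →
      G (x + I * α / 2) = κ * c.s x * G (x - I * α / 2)

/-! ### The Koornwinder–van Diejen operator -/

section Operator

variable (c : SCase) {N : ℕ} (g : Fin (2 * c.rho + 2) → ℝ) (lam β : ℝ)

/-- The sign `ε = ±1` as a complex number. -/
abbrev sgn (ε : ℤˣ) : ℂ := ((ε : ℤ) : ℂ)

/-- The point `x + t e_j`. -/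
def shift (x : Fin N → ℂ) (j : Fin N) (t : ℂ) : Fin N → ℂ := Function.update x j (x j + t)

/-- `|g| = ∑ g_ν`. -/
def gSum : ℝ := ∑ ν, g ν

/-- The coefficient `V_j^ε(x; g, λ, β)`. -/
def V (ε : ℤˣ) (j : Fin N) (x : Fin N → ℂ) : ℂ :=
  (∏ ν, c.s (sgn ε * x j - I * g ν * β)) /
      (c.s (sgn ε * 2 * x j) * c.s (sgn ε * 2 * x j - I * β)) *
    ∏ δ : ℤˣ, ∏ k ∈ Finset.univ.erase j,
      c.s (x j + sgn δ * x k - sgn ε * I * lam * β) / c.s (x j + sgn δ * x k)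

/-- The coefficient `V⁰(x; g, λ, β)`. -/
def V0 (x : Fin N → ℂ) : ℂ :=
  -c.prefactor * ∑ ν ∈ Finset.range (c.rho + 1),
    exp (-(c.rXi ν * (2 * lam * N + gSum c g - (c.rho + 1) * (lam + 1) / 2) * β)) /
      (∏ μ ∈ (Finset.range (c.rho + 1)).erase ν, c.s ((c.omega ν - c.omega μ) / 2)) *
    ((∏ μ, c.s (c.omega ν / 2 + I * β / 2 - I * g μ * β)) /
      ∏ μ ∈ Finset.range (c.rho + 1), c.s ((c.omega ν - c.omega μ + I * (1 - lam) * β) / 2)) *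
    ∏ δ : ℤˣ, ∏ j : Fin N,
      c.s (sgn δ * x j + c.omega ν / 2 + I * β / 2 - I * lam * β) /
        c.s (sgn δ * x j + c.omega ν / 2 + I * β / 2)

/-- The constant `c⁰`. -/
def c0 : ℂ :=
  c.prefactor * ∑ ν ∈ Finset.range (c.rho + 1),
    exp (-(c.rXi ν * (gSum c g - (c.rho + 1) * (lam + 1) / 2) * β)) /
      (∏ μ ∈ (Finset.range (c.rho + 1)).erase ν, c.s ((c.omega ν - c.omega μ) / 2)) *
    ((∏ μ, c.s (c.omega ν / 2 + I * lam * β / 2 - I * g μ * β)) /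
      ∏ μ ∈ Finset.range (c.rho + 1), c.s ((c.omega ν - c.omega μ + I * (lam - 1) * β) / 2))

/-- The eigenvalue `𝓔_N(g, λ, β)`. -/
def eigenvalue (N : ℕ) : ℂ :=
  c0 c g lam β + c.prefactor *
    c.s (I * β * (2 * lam * N + gSum c g - (c.rho + 1) * (lam + 1) / 2) - c.omegaSum)

/-- The Koornwinder–van Diejen operator `H_N` applied to `f` at `x`, where `R ε j` is the
chosen square root of `V ε j`, and `exp(-ε i β ∂/∂x_j)` is the shift of `x_j` by `-ε i β`. -/
def H (R : ℤˣ → Fin N → (Fin N → ℂ) → ℂ) (f : (Fin N → ℂ) → ℂ) (x : Fin N → ℂ) : ℂ :=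
  c.s (I * lam * β) * ∑ ε : ℤˣ, ∑ j : Fin N,
      R ε j x * (R (-ε) j (shift x j (-(sgn ε * I * β))) * f (shift x j (-(sgn ε * I * β))))
    + V0 c g lam β x * f x

/-- The function under the square roots in `Ψ_N`, so that `Ψ_N² = groundStateSq`. -/
def groundStateSq (G : ℂ → ℂ) (x : Fin N → ℂ) : ℂ :=
  (∏ j : Fin N, G (2 * x j + I * β / 2) * G (-(2 * x j) + I * β / 2) /
      ∏ ν, (G (x j + I * β / 2 - I * g ν * β) * G (-x j + I * β / 2 - I * g ν * β))) *
    ∏ j : Fin N, ∏ k ∈ Finset.Ioi j, ∏ ε : ℤˣ, ∏ ε' : ℤˣ,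
      G (sgn ε * x j + sgn ε' * x k + I * β / 2) /
        G (sgn ε * x j + sgn ε' * x k - I * lam * β + I * β / 2)

/-- `x` is a regular point: no factor of a denominator of the `V_j^±` and of `V⁰` vanishes at
`x`, and no Gamma factor of `Ψ_N` has a zero or a pole at `x`. -/
def IsRegular (G : ℂ → ℂ) (x : Fin N → ℂ) : Prop :=
  (∀ j, c.s (2 * x j) ≠ 0) ∧
  (∀ j, ∀ ε : ℤˣ, c.s (2 * x j + sgn ε * I * β) ≠ 0) ∧
  (∀ j k, j ≠ k → ∀ ε : ℤˣ, c.s (x j + sgn ε * x k) ≠ 0) ∧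
  (∀ j, ∀ ε : ℤˣ, G (sgn ε * 2 * x j + I * β / 2) ≠ 0) ∧
  (∀ j ν, ∀ ε : ℤˣ, G (sgn ε * x j + I * β / 2 - I * g ν * β) ≠ 0) ∧
  (∀ j k, j ≠ k → ∀ ε ε' : ℤˣ,
    G (sgn ε * x j + sgn ε' * x k + I * β / 2) ≠ 0 ∧
    G (sgn ε * x j + sgn ε' * x k - I * lam * β + I * β / 2) ≠ 0)

end Operator

end VanDiejen

end

open VanDiejen

open VanDiejen
open Filter Topology

/-! ### Functions with a three-term relation, and their partial fractions -/

namespace VanDiejen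

/-! Two independent facts combine: a detailed balance that removes the difference operators, and a
residue identity for what is left.

Detailed balance. For x = y + iβ e_j the functional equation of G gives V_j^-(y) Ψ(y)² = V_j^+(x)
Ψ(x)² (`V_mul_groundStateSq`); every power of κ cancels. Let R_j^+ be the given root of V_j^+. Then
V_j^+(x) Ψ(x) / (R_j^+(x) Ψ(y)) is a square root of V_j^-(y), and with this choice each shift term
of H_N Ψ collapses to V_j^ε Ψ. What remains is the scalar identity s(iλβ) ∑ V_j^ε + V⁰ = 𝓔_N
(`sum_V_add_V0`).

Residues. Consider, as a function of z, the product of s(z ± x_j - iλβ) over all j and signs and of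
s(z - i g_ν β) over all ν, divided by the product of s(z ± x_j) and by s(2z - iβ) s(2z - iλβ). By
the duplication formula the last two factors split over the half periods, so there are 2N + 2ρ + 2
zeros and as many poles. The poles ±x_j contribute V_j^±. The poles iβ/2 + ω_ν/2 contribute the
summands of V⁰. At the poles iλβ/2 + ω_ν/2 a reflection exchanges the zeros and poles that depend on
x, so x drops out and the summands of c⁰ appear. The total is s(sum of poles - sum of zeros)
(`SCase.sum_eq`): in the elliptic case the balancing condition makes it zero, as for residues of an
elliptic function; in the other cases it comes from the behaviour at infinity. This is the second
term of 𝓔_N.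

No contour is integrated over. Iterating the three-term relation gives a partial fraction expansion
with kernels s(z - a + t)/s(z - a) (`IsSigmaLike.partial_fractions`), from which both forms of the
sum follow. Function theory enters mainly through the three-term relation of the theta function
(`elliptic_s_three_term`), by quasi-periodicity, simplicity of the zeros and Liouville's theorem.
Continuity then removes the genericity assumptions. -/

/-- An odd entire function, not identically zero, that satisfies the three-term relation. -/
structure IsSigmaLike (s : ℂ → ℂ) : Prop where
  odd : ∀ x, s (-x) = -s x
  differentiable : Differentiable ℂ s
  nontrivial : ∃ w, s w ≠ 0
  three_term : ∀ x y u v, s (x + y) * s (x - y) * (s (u + v) * s (u - v)) +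
    s (x + u) * s (x - u) * (s (v + y) * s (v - y)) +
    s (x + v) * s (x - v) * (s (y + u) * s (y - u)) = 0

theorem eventually_ne_zero_of_differentiable {f : ℂ → ℂ} (hf : Differentiable ℂ f)
    (hne : ∃ w, f w ≠ 0) (x : ℂ) : ∀ᶠ y in 𝓝[≠] x, f y ≠ 0 := by
  have ha : AnalyticOnNhd ℂ f Set.univ := fun z _ => hf.analyticAt z
  rcases (hf.analyticAt x).eventually_eq_zero_or_eventually_ne_zero with h | h
  · obtain ⟨w, hw⟩ := hne
    exact absurd (ha.eqOn_zero_of_preconnected_of_eventuallyEq_zero isPreconnected_univ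
      (Set.mem_univ x) h (Set.mem_univ w)) hw
  · exact h

theorem eq_of_eventuallyEq_punctured {f g : ℂ → ℂ} {x : ℂ} (hf : ContinuousAt f x)
    (hg : ContinuousAt g x) (h : ∀ᶠ y in 𝓝[≠] x, f y = g y) : f x = g x :=
  tendsto_nhds_unique ((hf.tendsto.mono_left nhdsWithin_le_nhds).congr' h)
    (hg.tendsto.mono_left nhdsWithin_le_nhds)

namespace IsSigmaLike

variable {s : ℂ → ℂ} (hs : IsSigmaLike s)
include hs

theorem zero : s 0 = 0 := by
  have h := hs.odd 0
  rw [neg_zero] at h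
  linear_combination h / 2

theorem sub_comm (x y : ℂ) : s (x - y) = -s (y - x) := by
  rw [← hs.odd, neg_sub]

theorem eventually_ne (x : ℂ) : ∀ᶠ y in 𝓝[≠] x, s y ≠ 0 :=
  eventually_ne_zero_of_differentiable hs.differentiable hs.nontrivial x

theorem eventually_sub_ne (x : ℂ) : ∀ᶠ h in 𝓝[≠] (0 : ℂ), s (x - h) ≠ 0 := by
  obtain ⟨w, hw⟩ := hs.nontrivial
  refine eventually_ne_zero_of_differentiable (f := fun h => s (x - h))
    (hs.differentiable.comp (by fun_prop)) ⟨x - w, by simpa using hw⟩ 0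

/-- The three-term relation as a partial fraction decomposition with two poles. -/
theorem two_poles {z p a b t : ℂ} (hzp : s (z - p) ≠ 0) (hza : s (z - a) ≠ 0)
    (hpa : s (p - a) ≠ 0) :
    s (t + (a - b)) * (s (z - p + t) / s (z - p)) * (s (z - b) / s (z - a)) =
      s (z - p + (t + (a - b))) / s (z - p) * (s t * (s (p - b) / s (p - a))) +
      s (z - a + (t + (a - b))) / s (z - a) * (s (a - b) * (s (a - p + t) / s (a - p))) := by
  -- The arguments solve x + y = z - p + t, x - y = z - b, x - u = z - a, x - v = z - p.
  have h := hs.three_term ((2 * z - p + t - b) / 2) ((-p + t + b) / 2) ((t + 2 * a - b - p) / 2)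
    ((t - b + p) / 2)
  rw [show (2 * z - p + t - b) / 2 + (-p + t + b) / 2 = z - p + t by ring,
    show (2 * z - p + t - b) / 2 - (-p + t + b) / 2 = z - b by ring,
    show (t + 2 * a - b - p) / 2 + (t - b + p) / 2 = t + (a - b) by ring,
    show (t + 2 * a - b - p) / 2 - (t - b + p) / 2 = a - p by ring,
    show (2 * z - p + t - b) / 2 + (t + 2 * a - b - p) / 2 = z - p + (t + (a - b)) by ring,
    show (2 * z - p + t - b) / 2 - (t + 2 * a - b - p) / 2 = z - a by ring,
    show (t - b + p) / 2 + (-p + t + b) / 2 = t by ring,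
    show (t - b + p) / 2 - (-p + t + b) / 2 = p - b by ring,
    show (2 * z - p + t - b) / 2 + (t - b + p) / 2 = z - a + (t + (a - b)) by ring,
    show (2 * z - p + t - b) / 2 - (t - b + p) / 2 = z - p by ring,
    show (-p + t + b) / 2 + (t + 2 * a - b - p) / 2 = a - p + t by ring,
    show (-p + t + b) / 2 - (t + 2 * a - b - p) / 2 = b - a by ring,
    hs.sub_comm b a, hs.sub_comm a p] at h
  rw [hs.sub_comm a p]
  generalize s (t + (a - b)) = A at *
  generalize s (z - p + t) = B at *
  generalize s (z - p + (t + (a - b))) = C at *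
  generalize s (z - a + (t + (a - b))) = D at *
  generalize s (a - p + t) = E at *
  field_simp
  linear_combination -h

/-- Induction on the number of poles, with `two_poles` absorbing each new factor. No balancing is
needed: with t the sum of all a j - b j, the kernel s(z - a + t)/s(z - a) has the same
quasi-periodicity as the product. -/
theorem partial_fractions {ι : Type*} [DecidableEq ι] (S : Finset ι) (a : ι → ℂ)
    (ha : ∀ i ∈ S, ∀ j ∈ S, i ≠ j → s (a i - a j) ≠ 0) (b : ι → ℂ) (z : ℂ)
    (hz : ∀ i ∈ S, s (z - a i) ≠ 0) :
    s (∑ j ∈ S, (a j - b j)) * ∏ j ∈ S, s (z - b j) / s (z - a j) =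
      ∑ i ∈ S, s (z - a i + ∑ j ∈ S, (a j - b j)) / s (z - a i) *
        (s (a i - b i) * ∏ j ∈ S.erase i, s (a i - b j) / s (a i - a j)) := by
  induction S using Finset.induction_on generalizing b z with
  | empty => simp [hs.zero]
  | insert n S hn ih =>
    have ih' := ih fun i hi j hj => ha i (Finset.mem_insert_of_mem hi) j (Finset.mem_insert_of_mem hj)
    have hna : ∀ i ∈ S, s (a n - a i) ≠ 0 := fun i hi =>
      ha n (Finset.mem_insert_self _ _) i (Finset.mem_insert_of_mem hi) (by grind)
    have han : ∀ i ∈ S, s (a i - a n) ≠ 0 := fun i hi => by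
      rw [hs.sub_comm]; exact neg_ne_zero.2 (hna i hi)
    have hzn := hz n (Finset.mem_insert_self _ _)
    -- The induction hypothesis only describes the old product times s(t), with t the old sum, so
    -- s(t) must be cancelled at the end. It is used twice: at z, and at the new pole a n to
    -- identify the new coefficient.
    have key : ∀ b : ι → ℂ, s (∑ j ∈ S, (a j - b j)) ≠ 0 →
        s (∑ j ∈ insert n S, (a j - b j)) * ∏ j ∈ insert n S, s (z - b j) / s (z - a j) =
        ∑ i ∈ insert n S, s (z - a i + ∑ j ∈ insert n S, (a j - b j)) / s (z - a i) *
        (s (a i - b i) * ∏ j ∈ (insert n S).erase i, s (a i - b j) / s (a i - a j)) := by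
      intro b hb
      have h1 := ih' b z fun i hi => hz i (Finset.mem_insert_of_mem hi)
      have h2 := ih' b (a n) hna
      rw [Finset.sum_insert hn, Finset.prod_insert hn, Finset.sum_insert hn,
        Finset.erase_insert hn, add_comm (a n - b n)]
      set t := ∑ j ∈ S, (a j - b j) with ht
      have e : ∀ i ∈ S, ∏ j ∈ (insert n S).erase i, s (a i - b j) / s (a i - a j) =
          s (a i - b n) / s (a i - a n) * ∏ j ∈ S.erase i, s (a i - b j) / s (a i - a j) := by
        intro i hi
        rw [Finset.erase_insert_of_ne (by grind), Finset.prod_insert (by simp [hn])]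
      rw [Finset.sum_congr rfl fun i hi => by rw [e i hi]]
      apply mul_left_cancel₀ hb
      have h3 : s (t + (a n - b n)) * (s (z - b n) / s (z - a n)) *
          (s t * ∏ j ∈ S, s (z - b j) / s (z - a j)) =
          s (z - a n + (t + (a n - b n))) / s (z - a n) * s (a n - b n) *
          (s t * ∏ j ∈ S, s (a n - b j) / s (a n - a j)) + s t *
          ∑ i ∈ S, s (z - a i + (t + (a n - b n))) / s (z - a i) *
            (s (a i - b i) * (s (a i - b n) / s (a i - a n) *
              ∏ j ∈ S.erase i, s (a i - b j) / s (a i - a j))) := by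
        rw [h1, h2, Finset.mul_sum, Finset.mul_sum, Finset.mul_sum, ← Finset.sum_add_distrib]
        refine Finset.sum_congr rfl fun i hi => ?_
        have h4 := hs.two_poles (z := z) (p := a i) (a := a n) (b := b n) (t := t)
          (hz i (Finset.mem_insert_of_mem hi)) hzn (han i hi)
        linear_combination (s (a i - b i) * ∏ j ∈ S.erase i, s (a i - b j) / s (a i - a j)) * h4
      linear_combination h3
    rcases S.eq_empty_or_nonempty with rfl | ⟨m, hm⟩
    · simp only [insert_empty_eq, Finset.sum_singleton, Finset.prod_singleton,
        Finset.erase_singleton, Finset.prod_empty]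
      rw [show z - a n + (a n - b n) = z - b n by ring]
      ring
    · have hmn : m ≠ n := by grind
      -- To reach s(t) = 0, move one old zero by h and the new zero by -h: t becomes t - h while the
      -- full sum is unchanged. Then let h tend to 0.
      let B : ℂ → ι → ℂ := fun h j => if j = m then b j + h else if j = n then b j - h else b j
      have hB : ∀ j, Continuous fun h => B h j := by
        intro j
        simp only [B]
        split_ifs <;> fun_prop
      have hB0 : B 0 = b := by ext j; simp [B]
      have hsc := hs.differentiable.continuous
      have hBS : ∀ h, ∑ j ∈ S, (a j - B h j) = ∑ j ∈ S, (a j - b j) - h := by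
        intro h
        rw [← Finset.add_sum_erase _ _ hm, ← Finset.add_sum_erase S (fun j => a j - b j) hm]
        have : ∑ j ∈ S.erase m, (a j - B h j) = ∑ j ∈ S.erase m, (a j - b j) :=
          Finset.sum_congr rfl fun j hj => by
            have h1 : j ≠ m := by grind
            have h2 : j ≠ n := by grind
            simp [B, h1, h2]
        rw [this]; simp [B]; ring
      have := eq_of_eventuallyEq_punctured (x := 0)
        (f := fun h => s (∑ j ∈ insert n S, (a j - B h j)) *
          ∏ j ∈ insert n S, s (z - B h j) / s (z - a j))
        (g := fun h => ∑ i ∈ insert n S, s (z - a i + ∑ j ∈ insert n S, (a j - B h j)) / s (z - a i) *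
          (s (a i - B h i) * ∏ j ∈ (insert n S).erase i, s (a i - B h j) / s (a i - a j)))
        (by apply Continuous.continuousAt; simp only [div_eq_mul_inv]; fun_prop)
        (by apply Continuous.continuousAt; simp only [div_eq_mul_inv]; fun_prop)
        (by
          filter_upwards [hs.eventually_sub_ne (∑ j ∈ S, (a j - b j))] with h hh
          exact key _ (by rw [hBS]; exact hh))
      simpa only [hB0] using this

/-- Expand over all poles except a n and evaluate at z = a n. Balancing makes the remaining sum b n
- a n, so the kernel numerators become s(b n - a i), exactly the factors missing from the other
summands. -/
theorem balanced_sum {ι : Type*} [Fintype ι] [DecidableEq ι] (a b : ι → ℂ)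
    (ha : ∀ i j, i ≠ j → s (a i - a j) ≠ 0) (hab : ∑ j, (a j - b j) = 0) :
    ∑ i, (∏ j, s (a i - b j)) / ∏ j ∈ Finset.univ.erase i, s (a i - a j) = 0 := by
  rcases isEmpty_or_nonempty ι with _ | ⟨⟨n⟩⟩
  · simp
  have h := hs.partial_fractions (Finset.univ.erase n) a (fun i _ j _ => ha i j) b (a n)
    (fun i hi => ha n i (by grind))
  have ht : ∑ j ∈ Finset.univ.erase n, (a j - b j) = b n - a n := by
    rw [← Finset.add_sum_erase _ _ (Finset.mem_univ n)] at hab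
    linear_combination hab
  rw [ht] at h
  rw [← Finset.add_sum_erase _ _ (Finset.mem_univ n)]
  have e1 : (∏ j, s (a n - b j)) / ∏ j ∈ Finset.univ.erase n, s (a n - a j) =
      -(s (b n - a n) * ∏ j ∈ Finset.univ.erase n, s (a n - b j) / s (a n - a j)) := by
    rw [← Finset.mul_prod_erase _ _ (Finset.mem_univ n), Finset.prod_div_distrib, hs.sub_comm (b n)]
    ring
  rw [e1, h, neg_add_eq_zero]
  refine Finset.sum_congr rfl fun i hi => ?_
  have hin : i ≠ n := Finset.ne_of_mem_erase hi
  have h1 := ha n i hin.symm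
  rw [← Finset.mul_prod_erase _ _ (Finset.mem_univ i),
    ← Finset.mul_prod_erase (Finset.univ.erase i) _ (show n ∈ _ by simp [hin.symm]),
    ← Finset.mul_prod_erase (Finset.univ.erase i) _ (show n ∈ _ by simp [hin.symm]),
    Finset.erase_right_comm, Finset.prod_div_distrib, sub_add_sub_cancel',
    hs.sub_comm (b n), hs.sub_comm (a i) (a n)]
  field_simp

/-- If quotients of translates of `s` have an exponential limit along some filter, then the
balancing condition is not needed. -/
theorem unbalanced_sum {ι : Type*} [Fintype ι] [DecidableEq ι] (a b : ι → ℂ)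
    (ha : ∀ i j, i ≠ j → s (a i - a j) ≠ 0) (E : Multiplicative ℂ →* ℂ) (l : Filter ℂ) [l.NeBot]
    (hl : ∀ u v, Tendsto (fun z => s (z + u) / s (z + v)) l (𝓝 (E (.ofAdd (u - v)))))
    (hl' : ∀ v, ∀ᶠ z in l, s (z + v) ≠ 0) :
    ∑ i, (∏ j, s (a i - b j)) / ∏ j ∈ Finset.univ.erase i, s (a i - a j) =
      s (∑ j, (a j - b j)) := by
  have hE : ∀ w, E w ≠ 0 := fun w h => by
    have := E.map_mul w w⁻¹
    rw [h, mul_inv_cancel, map_one, zero_mul] at this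
    exact one_ne_zero this
  set t := ∑ j, (a j - b j) with ht
  -- Along `l` the product and each kernel both tend to E(t); cancelling this nonzero number from
  -- the limit of the expansion leaves the claim.
  have h1 : Tendsto (fun z => s t * ∏ j, s (z - b j) / s (z - a j)) l
      (𝓝 (s t * E (.ofAdd t))) := by
    rw [ht, ofAdd_sum, map_prod]
    refine (tendsto_finsetProd _ fun j _ => ?_).const_mul _
    simpa [sub_eq_add_neg, add_comm] using hl (-b j) (-a j)
  have h2 : Tendsto (fun z => ∑ i, s (z - a i + t) / s (z - a i) *
      (s (a i - b i) * ∏ j ∈ Finset.univ.erase i, s (a i - b j) / s (a i - a j))) l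
      (𝓝 (∑ i, E (.ofAdd t) *
      (s (a i - b i) * ∏ j ∈ Finset.univ.erase i, s (a i - b j) / s (a i - a j)))) := by
    refine tendsto_finsetSum _ fun i _ => Tendsto.mul_const _ ?_
    have := hl (t - a i) (-a i)
    rw [show t - a i - -a i = t by ring] at this
    refine this.congr fun z => ?_
    rw [show z + (t - a i) = z - a i + t by ring, sub_eq_add_neg z]
  have h3 := tendsto_nhds_unique (h1.congr' ?_) h2
  · rw [← Finset.mul_sum, mul_comm] at h3
    rw [mul_left_cancel₀ (hE _) h3]
    refine Finset.sum_congr rfl fun i _ => ?_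
    rw [← Finset.mul_prod_erase _ _ (Finset.mem_univ i), Finset.prod_div_distrib]
    ring
  · filter_upwards [eventually_all.2 fun i => hl' (-a i)] with z hz
    exact hs.partial_fractions Finset.univ a (fun i _ j _ => ha i j) b z fun i _ => by
      simpa [sub_eq_add_neg] using hz i

end IsSigmaLike

/-! ### The rational and the sine sums -/

theorem isSigmaLike_id : IsSigmaLike fun x => x where
  odd _ := rfl
  differentiable := differentiable_id
  nontrivial := ⟨1, one_ne_zero⟩
  three_term x y u v := by ring

theorem sum_id {ι : Type*} [Fintype ι] [DecidableEq ι] (a b : ι → ℂ)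
    (ha : ∀ i j, i ≠ j → a i - a j ≠ 0) :
    ∑ i, (∏ j, (a i - b j)) / ∏ j ∈ Finset.univ.erase i, (a i - a j) = ∑ j, (a j - b j) := by
  -- Quotients of translates of the identity tend to 1 at infinity, so the character is trivial.
  refine isSigmaLike_id.unbalanced_sum a b ha 1 (Bornology.cobounded ℂ) (fun u v => ?_) fun v => ?_
  · have h : Tendsto (fun z : ℂ => z + v) (Bornology.cobounded ℂ) (Bornology.cobounded ℂ) :=
      tendsto_add_const_cobounded v
    have h2 : Tendsto (fun z : ℂ => 1 + (u - v) * (z + v)⁻¹) (Bornology.cobounded ℂ) (𝓝 (1 + (u - v) * 0)) :=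
      ((tendsto_inv₀_cobounded.comp h).const_mul _).const_add _
    rw [mul_zero, add_zero] at h2
    refine h2.congr' ?_
    filter_upwards [h.eventually (Bornology.eventually_ne_cobounded 0)] with z hz
    field_simp
    ring
  · exact (tendsto_add_const_cobounded v).eventually (Bornology.eventually_ne_cobounded 0)

theorem isSigmaLike_sin {k : ℂ} (hk : k ≠ 0) : IsSigmaLike fun x => sin (k * x) / k where
  odd x := by simp [neg_div]
  differentiable := by fun_prop
  nontrivial := ⟨Real.pi / 2 / k, by rw [mul_div_cancel₀ _ hk]; simp [hk]⟩
  three_term x y u v := by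
    -- Whenever s(x + y) s(x - y) has the form f(x) - f(y), the three-term relation is a cyclic
    -- cancellation.
    have e : ∀ x y : ℂ, sin (k * (x + y)) / k * (sin (k * (x - y)) / k) =
        (sin (k * x) ^ 2 - sin (k * y) ^ 2) / k ^ 2 := by
      intro x y
      rw [mul_add, mul_sub, sin_add, sin_sub]
      have h1 := sin_sq_add_cos_sq (k * x)
      have h2 := sin_sq_add_cos_sq (k * y)
      field_simp
      linear_combination -sin (k * y) ^ 2 * h1 + sin (k * x) ^ 2 * h2
    rw [e, e, e, e, e, e]
    ring

theorem sum_sin {k : ℂ} (hk : k ≠ 0) {ι : Type*} [Fintype ι] [DecidableEq ι] (a b : ι → ℂ)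
    (ha : ∀ i j, i ≠ j → sin (k * (a i - a j)) / k ≠ 0) :
    ∑ i, (∏ j, sin (k * (a i - b j)) / k) / ∏ j ∈ Finset.univ.erase i, sin (k * (a i - a j)) / k =
      sin (k * ∑ j, (a j - b j)) / k := by
  -- Let k z = iM with M → +∞: the sine is dominated by exp(-i k z), whose translation behaviour is
  -- this character.
  let E : Multiplicative ℂ →* ℂ :=
    { toFun := fun w => exp (-(k * w.toAdd) * I)
      map_one' := by simp
      map_mul' := fun x y => by rw [← exp_add]; congr 1; simp; ring }
  have hdec : Tendsto (fun M : ℝ => exp (-2 * (M : ℂ))) atTop (𝓝 0) := by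
    have : Tendsto (fun M : ℝ => ((Real.exp (-2 * M) : ℝ) : ℂ)) atTop (𝓝 ((0 : ℝ) : ℂ)) :=
      (continuous_ofReal.tendsto 0).comp
        (Real.tendsto_exp_atBot.comp (tendsto_id.const_mul_atTop_of_neg (by norm_num)))
    simpa using this
  have hsin : ∀ (M : ℝ) (v : ℂ), sin (k * (I * M / k + v)) =
      exp M * (I / 2) * (exp (-(k * v) * I) - exp (-2 * (M : ℂ)) * exp (k * v * I)) := by
    intro M v
    have : k * (I * M / k + v) = I * M + k * v := by field_simp
    rw [this, sin, show -(I * M + k * v) * I = M + -(k * v) * I by ring_nf; rw [I_sq]; ring,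
      show (I * M + k * v) * I = M + (-2 * M + k * v * I) by ring_nf; rw [I_sq]; ring,
      exp_add, exp_add, exp_add]
    ring
  have hlim : ∀ v, Tendsto (fun M : ℝ => exp (-(k * v) * I) - exp (-2 * (M : ℂ)) * exp (k * v * I))
      atTop (𝓝 (exp (-(k * v) * I))) := fun v => by
    simpa using (hdec.mul_const (exp (k * v * I))).const_sub (exp (-(k * v) * I))
  refine (isSigmaLike_sin hk).unbalanced_sum a b ha E (map (fun M : ℝ => I * M / k) atTop)
    (fun u v => ?_) fun v => ?_
  · rw [tendsto_map'_iff]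
    have h := (hlim u).div (hlim v) (exp_ne_zero _)
    rw [← exp_sub] at h
    have hE : E (.ofAdd (u - v)) = exp (-(k * u) * I - -(k * v) * I) := by
      change exp _ = _
      congr 1
      simp
      ring
    rw [hE]
    refine h.congr fun M => ?_
    simp only [Function.comp, hsin, Pi.div_apply]
    rw [div_div_div_cancel_right₀ hk, mul_div_mul_left]
    exact mul_ne_zero (exp_ne_zero _) (div_ne_zero I_ne_zero two_ne_zero)
  · rw [eventually_map]
    filter_upwards [(hlim v).eventually_ne (exp_ne_zero _)] with M hM
    rw [hsin]
    have := exp_ne_zero (M : ℂ)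
    have := I_ne_zero
    simp only [ne_eq, div_eq_zero_iff, mul_eq_zero, not_or]
    exact ⟨⟨⟨by assumption, by assumption, two_ne_zero⟩, hM⟩, hk⟩

/-! ### Euler products -/

/-- The Euler product `∏_{n≥1} (1 - q^n w)`. -/
noncomputable def eulerProd (q w : ℂ) : ℂ := ∏' n : ℕ, (1 - q ^ (n + 1) * w)

section EulerProd

variable {q : ℂ} (hq : ‖q‖ < 1)
include hq

theorem summable_norm_pow_succ_mul (w : ℂ) : Summable fun n : ℕ => ‖-(q ^ (n + 1) * w)‖ := by
  simp only [norm_neg, norm_mul, norm_pow, pow_succ]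
  exact ((summable_geometric_of_lt_one (norm_nonneg _) hq).mul_right _).mul_right _

theorem multipliable_eulerProd (w : ℂ) : Multipliable fun n : ℕ => 1 - q ^ (n + 1) * w := by
  simpa [sub_eq_add_neg] using multipliable_one_add_of_summable (summable_norm_pow_succ_mul hq w)

theorem eulerProd_ne_zero {w : ℂ} (h : ∀ n : ℕ, q ^ (n + 1) * w ≠ 1) : eulerProd q w ≠ 0 := by
  refine tprod_one_add_ne_zero_of_summable (f := fun n => -(q ^ (n + 1) * w)) (fun n h0 => h n ?_)
    (summable_norm_pow_succ_mul hq w)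
  linear_combination -h0

theorem eulerProd_eq_mul (w : ℂ) : eulerProd q w = (1 - q * w) * eulerProd q (q * w) := by
  have h : ∀ n : ℕ, 1 - q ^ (n + 1) * (q * w) = 1 - q ^ (n + 1 + 1) * w := fun n => by ring
  have hm := multipliable_eulerProd hq (q * w)
  simp_rw [h] at hm
  have := tprod_eq_zero_mul' (f := fun n : ℕ => 1 - q ^ (n + 1) * w) hm
  simp only [eulerProd, h]
  rw [this]
  simp

theorem differentiable_eulerProd : Differentiable ℂ (eulerProd q) := by
  rw [← differentiableOn_univ]
  have h : HasProdLocallyUniformlyOn (fun (n : ℕ) w => 1 - q ^ (n + 1) * w) (eulerProd q)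
      Set.univ := by
    refine hasProdLocallyUniformlyOn_of_forall_compact isOpen_univ fun K _ hK => ?_
    obtain ⟨C, hC⟩ := hK.isBounded.exists_norm_le
    have := ((summable_geometric_of_lt_one (norm_nonneg _) hq).mul_right
      (‖q‖ * C)).hasProdUniformlyOn_nat_one_add (f := fun n w => -(q ^ (n + 1) * w)) hK
      (.of_forall fun n w hw => ?_) fun n => by fun_prop
    · simp only [← sub_eq_add_neg] at this
      exact this
    · rw [norm_neg, norm_mul, norm_pow, pow_succ, mul_assoc]
      gcongr
      exact hC w hw
  exact h.differentiableOn (.of_forall fun S => by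
    simpa [Finset.prod_fn] using DifferentiableOn.finsetProd (fun _ _ => by fun_prop)) isOpen_univ

end EulerProd

/-! ### The theta function: product form, quasi-periods, zeros -/

section Elliptic

variable {r a : ℝ} (hr : 0 < r) (ha : 0 < a)

theorem norm_exp_neg_two_lt_one (hr : 0 < r) (ha : 0 < a) : ‖exp (-(2 * r * a) : ℂ)‖ < 1 := by
  rw [norm_exp]
  simp only [neg_re, Real.exp_lt_one_iff]
  have : (2 * r * a : ℂ).re = 2 * r * a := by norm_cast
  rw [this]
  have := mul_pos hr ha
  linarith

include hr ha

/-- Here τ = ira/π, so the nome exp(2πiτ) is exp(-2ra), and the factor exp(ra/4) in s cancels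
exp(iπτ/4). The quadratic factors split as (1 - qⁿw)(1 - qⁿ/w) with w = exp(2irx). -/
theorem elliptic_s_eq (x : ℂ) : (SCase.elliptic r a).s x =
    2 / r * sin (r * x) * (eulerProd (exp (-(2 * r * a))) 1 *
      eulerProd (exp (-(2 * r * a))) (exp (2 * I * r * x)) *
      eulerProd (exp (-(2 * r * a))) (exp (-(2 * I * r * x)))) := by
  have hq := norm_exp_neg_two_lt_one hr ha
  have hπ : (Real.pi : ℂ) ≠ 0 := ofReal_ne_zero.2 Real.pi_ne_zero
  set q := exp (-(2 * r * a) : ℂ) with hqd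
  simp only [eulerProd]
  rw [← Multipliable.tprod_mul (multipliable_eulerProd hq _) (multipliable_eulerProd hq _),
    ← Multipliable.tprod_mul ((multipliable_eulerProd hq _).mul (multipliable_eulerProd hq _))
      (multipliable_eulerProd hq _)]
  have e1 : ∀ n : ℕ, exp (2 * I * Real.pi * (n + 1) * (I * r * a / Real.pi)) = q ^ (n + 1) := by
    intro n
    rw [hqd, ← exp_nat_mul]
    congr 1
    field_simp
    push_cast
    rw [I_sq]
    ring
  have e2 : ∀ n : ℕ, exp (4 * I * Real.pi * (n + 1) * (I * r * a / Real.pi)) = q ^ (n + 1) * q ^ (n + 1) := by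
    intro n
    rw [← e1, ← exp_add]
    ring_nf
  have e3 : exp (r * a / 4) * exp (I * Real.pi * (I * r * a / Real.pi) / 4) = 1 := by
    rw [← exp_add, ← exp_zero]
    congr 1
    field_simp
    rw [I_sq]
    ring
  have e4 : 2 * cos (2 * (r * x)) = exp (2 * I * r * x) + exp (-(2 * I * r * x)) := by
    rw [cos]
    ring_nf
  have e5 : exp (2 * I * r * x) * exp (-(2 * I * r * x)) = 1 := by
    rw [← exp_add, add_neg_cancel, exp_zero]
  simp only [SCase.s, theta1]
  have e6 : ∀ n : ℕ, (1 - exp (2 * I * Real.pi * (n + 1) * (I * r * a / Real.pi))) *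
      (1 - 2 * exp (2 * I * Real.pi * (n + 1) * (I * r * a / Real.pi)) * cos (2 * (r * x))
        + exp (4 * I * Real.pi * (n + 1) * (I * r * a / Real.pi))) =
      (1 - q ^ (n + 1) * 1) * (1 - q ^ (n + 1) * exp (2 * I * r * x)) *
        (1 - q ^ (n + 1) * exp (-(2 * I * r * x))) := by
    intro n
    rw [e1, e2]
    linear_combination (1 - q ^ (n + 1)) * (-q ^ (n + 1) * e4 - q ^ (n + 1) * q ^ (n + 1) * e5)
  simp_rw [e6]
  linear_combination (2 / r * sin (r * x) * ∏' n : ℕ, ((1 - q ^ (n + 1) * 1) * (1 - q ^ (n + 1) * exp (2 * I * r * x)) *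
        (1 - q ^ (n + 1) * exp (-(2 * I * r * x))))) * e3

theorem elliptic_s_odd (x : ℂ) : (SCase.elliptic r a).s (-x) = -(SCase.elliptic r a).s x := by
  rw [elliptic_s_eq hr ha, elliptic_s_eq hr ha, mul_neg, sin_neg, mul_neg (2 * I * r), neg_neg]
  ring

theorem differentiable_elliptic_s : Differentiable ℂ (SCase.elliptic r a).s := by
  have h := differentiable_eulerProd (norm_exp_neg_two_lt_one hr ha)
  have e : (SCase.elliptic r a).s = _ := funext (elliptic_s_eq hr ha)
  rw [e]
  have h1 := h.comp (show Differentiable ℂ fun x : ℂ => exp (2 * I * r * x) by fun_prop)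
  have h2 := h.comp (show Differentiable ℂ fun x : ℂ => exp (-(2 * I * r * x)) by fun_prop)
  have h3 : Differentiable ℂ fun x : ℂ => 2 / r * sin (r * x) := by fun_prop
  exact h3.mul ((h1.const_mul _).mul h2)

theorem eulerProd_one_ne_zero : eulerProd (exp (-(2 * r * a))) 1 ≠ 0 := by
  have hq := norm_exp_neg_two_lt_one hr ha
  refine eulerProd_ne_zero hq fun n h => ?_
  have h2 : ‖exp (-(2 * r * a) : ℂ)‖ ^ (n + 1) = 1 := by
    rw [← norm_pow, ← mul_one (_ ^ (n + 1)), h, norm_one]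
  exact (pow_lt_one₀ (norm_nonneg _) hq (Nat.succ_ne_zero n)).ne h2

/-- Only the sine vanishes at 0, so the derivative there is 2 times the cube of ∏(1 - qⁿ). -/
theorem deriv_elliptic_s_zero : deriv (SCase.elliptic r a).s 0 ≠ 0 := by
  have hr' : (r : ℂ) ≠ 0 := ofReal_ne_zero.2 hr.ne'
  have h := differentiable_eulerProd (norm_exp_neg_two_lt_one hr ha)
  have h1 := h.comp (show Differentiable ℂ fun x : ℂ => exp (2 * I * r * x) by fun_prop)
  have h2 := h.comp (show Differentiable ℂ fun x : ℂ => exp (-(2 * I * r * x)) by fun_prop)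
  have e : (SCase.elliptic r a).s = _ := funext (elliptic_s_eq hr ha)
  have h3 : HasDerivAt (fun x : ℂ => 2 / r * sin (r * x)) (2 / r * (cos (r * 0) * (r * 1))) 0 :=
    (((hasDerivAt_id (0 : ℂ)).const_mul (r : ℂ)).csin).const_mul _
  have h4 := (h3.mul (((h1.const_mul (eulerProd (exp (-(2 * r * a))) 1)).mul h2) 0).hasDerivAt).deriv
  rw [e]
  refine ne_of_eq_of_ne h4 ?_
  have h5 := eulerProd_one_ne_zero hr ha
  simp [hr', h5]

theorem elliptic_s_add_omega_one (x : ℂ) :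
    (SCase.elliptic r a).s (x + Real.pi / r) = -(SCase.elliptic r a).s x := by
  have hr' : (r : ℂ) ≠ 0 := ofReal_ne_zero.2 hr.ne'
  rw [elliptic_s_eq hr ha, elliptic_s_eq hr ha,
    show r * (x + Real.pi / r) = r * x + Real.pi by field_simp, sin_add_pi,
    show 2 * I * r * (x + Real.pi / r) = 2 * I * r * x + 2 * Real.pi * I by field_simp,
    neg_add, ← sub_eq_add_neg, exp_periodic, exp_periodic.sub_eq]
  ring

/-- The translation multiplies w = exp(2irx) by q, so one Euler product loses its first factor and
the other gains one; together with the change of the sine this leaves an exponential multiplier. -/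
theorem elliptic_s_add_omega_two (x : ℂ) : (SCase.elliptic r a).s (x + I * a) =
    -(exp (r * a - 2 * I * r * x) * (SCase.elliptic r a).s x) := by
  have hq := norm_exp_neg_two_lt_one hr ha
  rw [elliptic_s_eq hr ha, elliptic_s_eq hr ha]
  set q := exp (-(2 * r * a) : ℂ) with hqd
  set w := exp (2 * I * r * x) with hw
  set W := exp (-(2 * I * r * x)) with hW
  have e1 : exp (2 * I * r * (x + I * a)) = q * w := by
    rw [hqd, hw, ← exp_add]; congr 1; ring_nf; rw [I_sq]; ring
  have e2 : W = q * exp (-(2 * I * r * (x + I * a))) := by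
    rw [hqd, hW, ← exp_add]; congr 1; ring_nf; rw [I_sq]; ring
  have h1 := eulerProd_eq_mul hq w
  have h2 := eulerProd_eq_mul hq (exp (-(2 * I * r * (x + I * a))))
  rw [← e2] at h2
  rw [e1, h1, h2]
  have e3 : sin (r * (x + I * a)) * (1 - W) = -(exp (r * a - 2 * I * r * x) * sin (r * x) * (1 - q * w)) := by
    have h3 : exp (-(I * r * x)) * exp (I * r * x) = 1 := by
      rw [← exp_add, neg_add_cancel, exp_zero]
    have h4 : exp (r * a) * exp (-(r * a)) = 1 := by rw [← exp_add, add_neg_cancel, exp_zero]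
    rw [sin, sin, show -(r * (x + I * a)) * I = -(I * r * x) + r * a by ring_nf; rw [I_sq]; ring,
      show r * (x + I * a) * I = I * r * x + -(r * a) by ring_nf; rw [I_sq]; ring,
      show -(r * x) * I = -(I * r * x) by ring, show r * x * I = I * r * x by ring,
      show W = exp (-(I * r * x)) ^ 2 by rw [hW, sq, ← exp_add]; ring_nf,
      show w = exp (I * r * x) ^ 2 by rw [hw, sq, ← exp_add]; ring_nf,
      show q = exp (-(r * a)) ^ 2 by rw [hqd, sq, ← exp_add]; ring_nf,
      show r * a - 2 * I * r * x = r * a + (-(I * r * x) + -(I * r * x)) by ring,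
      exp_add, exp_add, exp_add, exp_add]
    generalize exp (-(I * r * x)) = F at *
    generalize exp (I * r * x) = E at *
    generalize exp (r * a) = P at *
    generalize exp (-(r * a)) = R at *
    linear_combination I / 2 * (-P * F - R * E * F ^ 2 + R * E * (E * F + 1)) * h3 +
      I / 2 * (-R * E ^ 2 * F ^ 3 + R * E ^ 3 * F ^ 2) * h4
  linear_combination (2 / r * eulerProd q 1 * eulerProd q (q * w) * eulerProd q W) * e3

/-- A convergent Euler product vanishes only if one of its factors does; the sine gives the real
periods, the two Euler products the rest of the lattice. -/
theorem elliptic_s_eq_zero {x : ℂ} (h : (SCase.elliptic r a).s x = 0) :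
    ∃ m n : ℤ, x = m * (Real.pi / r) + n * (I * a) := by
  have hr' : (r : ℂ) ≠ 0 := ofReal_ne_zero.2 hr.ne'
  have hq := norm_exp_neg_two_lt_one hr ha
  by_contra! hx
  have e0 : ∀ n : ℕ, exp (-(2 * r * a) : ℂ) ^ (n + 1) = exp (2 * I * r * ((n + 1) * (I * a))) := by
    intro n
    rw [← exp_nat_mul]
    congr 1
    push_cast
    linear_combination (-(2 * r * (n + 1) * a) : ℂ) * I_sq
  rw [elliptic_s_eq hr ha] at h
  refine absurd h (mul_ne_zero (mul_ne_zero (div_ne_zero two_ne_zero hr') fun h0 => ?_)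
    (mul_ne_zero (mul_ne_zero (eulerProd_one_ne_zero hr ha) (eulerProd_ne_zero hq fun n h0 => ?_))
      (eulerProd_ne_zero hq fun n h0 => ?_)))
  · obtain ⟨m, hm⟩ := sin_eq_zero_iff.1 h0
    refine hx m 0 ?_
    field_simp
    linear_combination hm
  · rw [e0, ← exp_add, exp_eq_one_iff] at h0
    obtain ⟨m, hm⟩ := h0
    refine hx m (-(n + 1)) ?_
    push_cast
    have : I * (x * r) = I * (m * Real.pi - (n + 1) * I * a * r) := by linear_combination hm / 2
    have := mul_left_cancel₀ I_ne_zero this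
    field_simp
    linear_combination this
  · rw [e0, ← exp_add, exp_eq_one_iff] at h0
    obtain ⟨m, hm⟩ := h0
    refine hx (-m) (n + 1) ?_
    push_cast
    have : I * (x * r) = I * (-m * Real.pi + (n + 1) * I * a * r) := by linear_combination -hm / 2
    have := mul_left_cancel₀ I_ne_zero this
    field_simp
    linear_combination this

end Elliptic

/-! ### Division of entire functions and Liouville's theorem -/

/-- An entire function that vanishes on the zeros of an entire function with simple zeros is a
multiple of it. -/
theorem exists_eq_mul_of_simple_zeros {h p : ℂ → ℂ} (hh : Differentiable ℂ h)
    (hp : Differentiable ℂ p) (hz : ∀ x, p x = 0 → h x = 0 ∧ deriv p x ≠ 0) :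
    ∃ q : ℂ → ℂ, Differentiable ℂ q ∧ ∀ x, h x = q x * p x := by
  classical
  refine ⟨fun x => if p x = 0 then deriv h x / deriv p x else h x / p x, fun x₀ => ?_, fun x => ?_⟩
  · by_cases h0 : p x₀ = 0
    · obtain ⟨hh0, hp0⟩ := hz x₀ h0
      -- Near a common zero x₀ the quotient h/p is the quotient of the slopes at x₀, whose
      -- denominator is nonzero there since the zero of p is simple.
      have hdh : DifferentiableAt ℂ (dslope h x₀) x₀ :=
        ((Complex.differentiableOn_dslope univ_mem).2 hh.differentiableOn).differentiableAt univ_mem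
      have hdp : DifferentiableAt ℂ (dslope p x₀) x₀ :=
        ((Complex.differentiableOn_dslope univ_mem).2 hp.differentiableOn).differentiableAt univ_mem
      have hp0' : dslope p x₀ x₀ ≠ 0 := by rwa [dslope_same]
      refine (hdh.div hdp hp0').congr_of_eventuallyEq ?_
      filter_upwards [hdp.continuousAt.eventually_ne hp0'] with x hx
      simp only [Pi.div_apply]
      rcases eq_or_ne x x₀ with rfl | hne
      · simp [h0, dslope_same]
      · have e1 := sub_smul_dslope h x₀ x
        have e2 := sub_smul_dslope p x₀ x
        rw [hh0, sub_zero, smul_eq_mul] at e1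
        rw [h0, sub_zero, smul_eq_mul] at e2
        have hpx : p x ≠ 0 := by
          rw [← e2]
          exact mul_ne_zero (sub_ne_zero.2 hne) hx
        rw [if_neg hpx, ← e1, ← e2, mul_div_mul_left _ _ (sub_ne_zero.2 hne)]
    · refine ((hh x₀).div (hp x₀) h0).congr_of_eventuallyEq ?_
      filter_upwards [(hp x₀).continuousAt.eventually_ne h0] with x hx
      rw [if_neg hx, Pi.div_apply]
  · by_cases h0 : p x = 0
    · simp [h0, (hz x h0).1]
    · simp [h0]

/-- Two continuous functions agree if their products with a nonzero entire function do. -/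
theorem eq_of_mul_eq_mul {f g D : ℂ → ℂ} (hf : Continuous f) (hg : Continuous g)
    (hD : Differentiable ℂ D) (hne : ∃ w, D w ≠ 0) (h : ∀ x, f x * D x = g x * D x) : f = g := by
  ext x
  refine eq_of_eventuallyEq_punctured hf.continuousAt hg.continuousAt ?_
  filter_upwards [eventually_ne_zero_of_differentiable hD hne x] with y hy
  exact mul_right_cancel₀ hy (h y)

/-- Liouville's theorem for elliptic functions with a rectangular period lattice. -/
theorem eq_of_periodic_of_differentiable {q : ℂ → ℂ} (hq : Differentiable ℂ q) {b a : ℝ}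
    (hb : 0 < b) (ha : 0 < a) (h1 : Function.Periodic q b) (h2 : Function.Periodic q (I * a))
    (x y : ℂ) : q x = q y := by
  refine hq.apply_eq_apply_of_bounded ?_ x y
  refine Bornology.IsBounded.subset (((isCompact_Icc (a := 0) (b := b)).reProdIm
    (isCompact_Icc (a := 0) (b := a))).image hq.continuous).isBounded ?_
  rintro _ ⟨x, rfl⟩
  -- Subtracting periods brings the point into the closed period rectangle, so the range is the
  -- image of a compact set.
  refine ⟨x - ⌊x.re / b⌋ * b - ⌊x.im / a⌋ * (I * a), ?_, ?_⟩
  · have e1 := Int.floor_le (x.re / b)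
    have e2 := Int.lt_floor_add_one (x.re / b)
    have e3 := Int.floor_le (x.im / a)
    have e4 := Int.lt_floor_add_one (x.im / a)
    rw [le_div_iff₀ hb] at e1
    rw [div_lt_iff₀ hb] at e2
    rw [le_div_iff₀ ha] at e3
    rw [div_lt_iff₀ ha] at e4
    simp only [mem_reProdIm, Set.mem_Icc]
    simp
    refine ⟨⟨by linarith, by linarith⟩, by linarith, by linarith⟩
  · rw [h2.sub_int_mul_eq, h1.sub_int_mul_eq]

/-! ### The three-term relation for the theta function -/

section Elliptic

variable {r a : ℝ} (hr : 0 < r) (ha : 0 < a)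
include hr ha

theorem elliptic_s_zero : (SCase.elliptic r a).s 0 = 0 := by
  have h := elliptic_s_odd hr ha 0
  rw [neg_zero] at h
  linear_combination h / 2

theorem elliptic_s_nontrivial : ∃ w, (SCase.elliptic r a).s w ≠ 0 := by
  by_contra! h
  refine deriv_elliptic_s_zero hr ha ?_
  rw [show (SCase.elliptic r a).s = fun _ => 0 from funext h, deriv_const]

theorem elliptic_s_add_int_mul (n : ℤ) (x : ℂ) : (SCase.elliptic r a).s (x + n * (I * a)) =
    (-1) ^ n * exp (n ^ 2 * (r * a) - 2 * I * r * n * x) * (SCase.elliptic r a).s x := by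
  have hstep : ∀ (n : ℤ) x, (SCase.elliptic r a).s (x + (n + 1 : ℤ) * (I * a)) =
      -(exp ((2 * n + 1) * (r * a) - 2 * I * r * x) *
        (SCase.elliptic r a).s (x + n * (I * a))) := by
    intro n x
    rw [show x + (n + 1 : ℤ) * (I * a) = x + n * (I * a) + I * a by push_cast; ring,
      elliptic_s_add_omega_two hr ha]
    congr 3
    linear_combination (-2 * r * n * a : ℂ) * I_sq
  have hexp : ∀ (n : ℤ) (x : ℂ), exp ((n + 1 : ℤ) ^ 2 * (r * a) - 2 * I * r * (n + 1 : ℤ) * x) =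
      exp ((2 * n + 1) * (r * a) - 2 * I * r * x) * exp (n ^ 2 * (r * a) - 2 * I * r * n * x) := by
    intro n x
    rw [← exp_add]
    push_cast
    ring_nf
  induction n using Int.induction_on generalizing x with
  | zero => simp
  | succ n ih =>
    rw [hstep, ih, hexp, zpow_add_one₀ (by norm_num)]
    ring
  | pred n ih =>
    have h := hstep (-(n : ℤ) - 1) x
    have h2 := hexp (-(n : ℤ) - 1) x
    rw [sub_add_cancel] at h h2
    rw [ih, h2] at h
    have h3 := zpow_add_one₀ (show (-1 : ℂ) ≠ 0 by norm_num) (-(n : ℤ) - 1)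
    rw [sub_add_cancel] at h3
    rw [h3] at h
    refine mul_left_cancel₀ (exp_ne_zero ((2 * ((-(n : ℤ) - 1 : ℤ) : ℂ) + 1) * (r * a) - 2 * I * r * x)) ?_
    linear_combination h

theorem elliptic_s_add_period (m n : ℤ) (x : ℂ) :
    (SCase.elliptic r a).s (x + (m * (Real.pi / r) + n * (I * a))) =
    (-1) ^ m * (-1) ^ n * exp (n ^ 2 * (r * a) - 2 * I * r * n * x) *
      (SCase.elliptic r a).s x := by
  have h1 : Function.Antiperiodic (SCase.elliptic r a).s (Real.pi / r) :=
    elliptic_s_add_omega_one hr ha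
  have h2 := h1.add_int_mul_eq (x := x + n * (I * a)) m
  rw [← add_assoc, add_right_comm, h2, elliptic_s_add_int_mul hr ha,
    Int.cast_negOnePow]
  ring

/-- Every zero is a lattice point, and translation by it changes s only by a nonvanishing factor, so
the derivative is inherited from 0. -/
theorem deriv_elliptic_s_ne_zero {x : ℂ} (hx : (SCase.elliptic r a).s x = 0) :
    deriv (SCase.elliptic r a).s x ≠ 0 := by
  obtain ⟨m, n, rfl⟩ := elliptic_s_eq_zero hr ha hx
  set w := (m * (Real.pi / r) + n * (I * a) : ℂ) with hw
  have hd := differentiable_elliptic_s hr ha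
  have h1 : deriv (fun x => (SCase.elliptic r a).s (x + w)) 0 = deriv (SCase.elliptic r a).s w := by
    rw [deriv_comp_add_const, zero_add]
  have h2 : (fun x => (SCase.elliptic r a).s (x + w)) = fun x => _ :=
    funext (elliptic_s_add_period hr ha m n)
  have h3 := (((show DifferentiableAt ℂ (fun x => (-1) ^ m * (-1) ^ n *
    exp (n ^ 2 * (r * a) - 2 * I * r * n * x)) 0 by fun_prop).hasDerivAt).mul (hd 0).hasDerivAt).deriv
  rw [← h1, h2]
  refine ne_of_eq_of_ne h3 ?_
  rw [elliptic_s_zero hr ha, mul_zero, zero_add]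
  refine mul_ne_zero (mul_ne_zero (mul_ne_zero ?_ ?_) (exp_ne_zero _)) (deriv_elliptic_s_zero hr ha)
  all_goals exact zpow_ne_zero _ (by norm_num)

/-- The point is that the multiplier does not depend on w. Hence all three terms of the three-term
relation, as functions of x, have a common multiplier. -/
theorem elliptic_s_mul_add_period (m n : ℤ) (x w : ℂ) :
    (SCase.elliptic r a).s (x + (m * (Real.pi / r) + n * (I * a)) + w) *
      (SCase.elliptic r a).s (x + (m * (Real.pi / r) + n * (I * a)) - w) =
    exp (2 * (n ^ 2 * (r * a) - 2 * I * r * n * x)) *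
      ((SCase.elliptic r a).s (x + w) * (SCase.elliptic r a).s (x - w)) := by
  rw [add_right_comm, add_sub_right_comm, elliptic_s_add_period hr ha,
    elliptic_s_add_period hr ha]
  have e : exp (2 * (n ^ 2 * (r * a) - 2 * I * r * n * x)) =
      exp (n ^ 2 * (r * a) - 2 * I * r * n * (x + w)) *
      exp (n ^ 2 * (r * a) - 2 * I * r * n * (x - w)) := by
    rw [← exp_add]; ring_nf
  have h1 : ∀ k : ℤ, ((-1 : ℂ) ^ k) * (-1) ^ k = 1 := fun k => by
    rw [← mul_zpow]; simp
  rw [e]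
  linear_combination (exp (n ^ 2 * (r * a) - 2 * I * r * n * (x + w)) *
      exp (n ^ 2 * (r * a) - 2 * I * r * n * (x - w)) *
      ((SCase.elliptic r a).s (x + w) * (SCase.elliptic r a).s (x - w))) *
      ((-1) ^ n * (-1) ^ n * h1 m + h1 n)

/-- As a function of x, the left side has the multiplier of s(x + y) s(x - y) and vanishes at x =
±y. Their quotient is thus entire and doubly periodic, hence constant, and it vanishes at x = u. -/
theorem elliptic_s_three_term (x y u v : ℂ) :
    (SCase.elliptic r a).s (x + y) * (SCase.elliptic r a).s (x - y) *
      ((SCase.elliptic r a).s (u + v) * (SCase.elliptic r a).s (u - v)) +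
    (SCase.elliptic r a).s (x + u) * (SCase.elliptic r a).s (x - u) *
      ((SCase.elliptic r a).s (v + y) * (SCase.elliptic r a).s (v - y)) +
    (SCase.elliptic r a).s (x + v) * (SCase.elliptic r a).s (x - v) *
      ((SCase.elliptic r a).s (y + u) * (SCase.elliptic r a).s (y - u)) = 0 := by
  have hodd := elliptic_s_odd hr ha
  have hper := elliptic_s_mul_add_period hr ha
  have hzero := fun {x} => elliptic_s_eq_zero hr ha (x := x)
  have hd := differentiable_elliptic_s hr ha
  have h0 := elliptic_s_zero hr ha
  have hder := fun {x} => deriv_elliptic_s_ne_zero hr ha (x := x)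
  have hnt := elliptic_s_nontrivial hr ha
  have hadd := elliptic_s_add_period hr ha
  generalize (SCase.elliptic r a).s = s at *
  have hc := hd.continuous
  have hsub : ∀ x y, s (x - y) = -s (y - x) := fun x y => by rw [← hodd, neg_sub]
  let T : ℂ → ℂ → ℂ := fun x y => s (x + y) * s (x - y) * (s (u + v) * s (u - v)) +
    s (x + u) * s (x - u) * (s (v + y) * s (v - y)) +
    s (x + v) * s (x - v) * (s (y + u) * s (y - u))
  -- The condition s(2y) ≠ 0 makes the zeros of s(x + y) s(x - y) simple; the other two keep this
  -- divisor nonzero at x = u.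
  have generic : ∀ x y, s (2 * y) ≠ 0 → s (u + y) ≠ 0 → s (u - y) ≠ 0 → T x y = 0 := by
    intro x y hy hu1 hu2
    have hT : Differentiable ℂ fun x => T x y := by
      have h1 : ∀ w, Differentiable ℂ fun x => s (x + w) := fun w => hd.comp (by fun_prop)
      have h2 : ∀ w, Differentiable ℂ fun x => s (x - w) := fun w => hd.comp (by fun_prop)
      exact ((((h1 y).mul (h2 y)).mul_const _).add (((h1 u).mul (h2 u)).mul_const _)).add
        (((h1 v).mul (h2 v)).mul_const _)
    have hp : Differentiable ℂ fun x => s (x + y) * s (x - y) :=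
      (hd.comp (by fun_prop)).mul (hd.comp (by fun_prop))
    have hTper : ∀ (m n : ℤ) x, T (x + (m * (Real.pi / r) + n * (I * a))) y =
        exp (2 * (n ^ 2 * (r * a) - 2 * I * r * n * x)) * T x y := by
      intro m n x
      simp only [T, hper]
      ring
    have hTy : T y y = 0 := by
      simp only [T, sub_self, h0, hsub v y, add_comm v y]
      ring
    have hTny : T (-y) y = 0 := by
      simp only [T, show -y + y = 0 by ring, h0, hsub v y, add_comm v y,
        show ∀ w, -y + w = -(y - w) by intro w; ring, show ∀ w, -y - w = -(y + w) by intro w; ring,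
        hodd]
      ring
    obtain ⟨q, hq, hqT⟩ := exists_eq_mul_of_simple_zeros hT hp (by
      intro x hx
      have hdp : deriv (fun x => s (x + y) * s (x - y)) x =
          deriv s (x + y) * s (x - y) + s (x + y) * deriv s (x - y) := by
        have h1 := ((hd (x + y)).hasDerivAt.comp_add_const x y)
        have h2 := ((hd (x - y)).hasDerivAt.comp_sub_const x y)
        exact (h1.mul h2).deriv
      rw [hdp]
      rcases mul_eq_zero.1 hx with h | h
      · obtain ⟨m, n, hmn⟩ := hzero h
        have hxe : x = -y + (m * (Real.pi / r) + n * (I * a)) := by rw [← hmn]; ring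
        refine ⟨by rw [hxe, hTper, hTny, mul_zero], ?_⟩
        rw [h, zero_mul, add_zero]
        refine mul_ne_zero (hder h) fun h' => hy ?_
        have h2 : x - y = -(2 * y) + (m * (Real.pi / r) + n * (I * a)) := by rw [hxe]; ring
        rw [h2, hadd, hodd] at h'
        simpa [exp_ne_zero, zpow_ne_zero] using h'
      · obtain ⟨m, n, hmn⟩ := hzero h
        have hxe : x = y + (m * (Real.pi / r) + n * (I * a)) := by rw [← hmn]; ring
        refine ⟨by rw [hxe, hTper, hTy, mul_zero], ?_⟩
        rw [h, mul_zero, zero_add]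
        refine mul_ne_zero (fun h' => hy ?_) (hder h)
        have h2 : x + y = (2 * y) + (m * (Real.pi / r) + n * (I * a)) := by rw [hxe]; ring
        rw [h2, hadd] at h'
        simpa [exp_ne_zero, zpow_ne_zero] using h')
    have hqper : ∀ m n : ℤ, Function.Periodic q (m * (Real.pi / r) + n * (I * a)) := by
      intro m n
      refine congrFun (eq_of_mul_eq_mul (f := fun x => q (x + (m * (Real.pi / r) + n * (I * a))))
        (g := q) (hq.continuous.comp (by fun_prop)) hq.continuous hp ⟨u, mul_ne_zero hu1 hu2⟩ fun x => ?_)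
      have h1 := hqT (x + (m * (Real.pi / r) + n * (I * a)))
      simp only [hTper, hper, hqT x] at h1
      refine mul_left_cancel₀ (exp_ne_zero (2 * (n ^ 2 * (r * a) - 2 * I * r * n * x))) ?_
      linear_combination -h1
    have hq1 : Function.Periodic q ((Real.pi / r : ℝ) : ℂ) := by simpa using hqper 1 0
    have hq2 : Function.Periodic q (I * a) := by simpa using hqper 0 1
    have hqu : q u = 0 := by
      have h1 := hqT u
      have h2 : T u y = 0 := by
        simp only [T, sub_self, h0, hsub v y, add_comm v y, hsub y u, add_comm y u]
        ring
      rw [h2] at h1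
      exact (mul_eq_zero.1 h1.symm).resolve_right (mul_ne_zero hu1 hu2)
    rw [hqT, eq_of_periodic_of_differentiable hq (div_pos Real.pi_pos hr) ha hq1 hq2 x u, hqu,
      zero_mul]
  -- The excluded y are the zeros of one nonzero entire function, so continuity in y covers them.
  have hD : Differentiable ℂ fun y => s (2 * y) * s (u + y) * s (u - y) :=
    ((hd.comp (by fun_prop)).mul (hd.comp (by fun_prop))).mul (hd.comp (by fun_prop))
  have hDne : ∃ w, s (2 * w) * s (u + w) * s (u - w) ≠ 0 := by
    obtain ⟨w, hw⟩ := hnt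
    have e1 := eventually_ne_zero_of_differentiable (f := fun y => s (2 * y)) (hd.comp (by fun_prop))
      ⟨w / 2, by simpa [mul_div_cancel₀] using hw⟩ 0
    have e2 := eventually_ne_zero_of_differentiable (f := fun y => s (u + y)) (hd.comp (by fun_prop))
      ⟨w - u, by simpa using hw⟩ 0
    have e3 := eventually_ne_zero_of_differentiable (f := fun y => s (u - y)) (hd.comp (by fun_prop))
      ⟨u - w, by simpa using hw⟩ 0
    obtain ⟨y, h1, h2, h3⟩ := (e1.and (e2.and e3)).exists
    exact ⟨y, mul_ne_zero (mul_ne_zero h1 h2) h3⟩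
  refine congrFun (eq_of_mul_eq_mul (f := T x) (g := fun _ => 0) (by fun_prop) continuous_const hD
    hDne fun y => ?_) y
  rw [zero_mul, mul_eq_zero]
  by_contra! h
  have h2 := h.2
  simp only [ne_eq, mul_eq_zero, not_or] at h2
  exact h.1 (generic x y h2.1.1 h2.1.2 h2.2)

theorem isSigmaLike_elliptic : IsSigmaLike (SCase.elliptic r a).s where
  odd := elliptic_s_odd hr ha
  differentiable := differentiable_elliptic_s hr ha
  nontrivial := elliptic_s_nontrivial hr ha
  three_term := elliptic_s_three_term hr ha

end Elliptic

/-! ### The four cases treated uniformly: sums, half periods, duplication -/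

theorem trigonometric_s_eq (r : ℝ) (x : ℂ) : (SCase.trigonometric r).s x = sin (r * x) / r := by
  simp only [SCase.s]
  ring

theorem hyperbolic_s_eq (a : ℝ) (x : ℂ) :
    (SCase.hyperbolic a).s x = sin (I * Real.pi / a * x) / (I * Real.pi / a) := by
  simp only [SCase.s]
  rw [show I * Real.pi / a * x = Real.pi * x / a * I by ring, sin_mul_I]
  have := I_ne_zero
  field_simp

namespace SCase

variable {c : SCase}

theorem isSigmaLike (hc : c.Positive) : IsSigmaLike c.s := by
  match c, hc with
  | .rational, _ => exact isSigmaLike_id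
  | .trigonometric r, hr =>
    rw [show SCase.s (.trigonometric r) = _ from funext (trigonometric_s_eq r)]
    exact isSigmaLike_sin (ofReal_ne_zero.2 (ne_of_gt hr))
  | .hyperbolic a, ha =>
    rw [show SCase.s (.hyperbolic a) = _ from funext (hyperbolic_s_eq a)]
    exact isSigmaLike_sin (div_ne_zero (mul_ne_zero I_ne_zero (ofReal_ne_zero.2 Real.pi_ne_zero))
      (ofReal_ne_zero.2 (ne_of_gt ha)))
  | .elliptic r a, h => exact isSigmaLike_elliptic h.1 h.2

/-- In the elliptic case the right side is s(0) = 0, so one formula expresses both the balanced and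
the unbalanced sum. -/
theorem sum_eq (hc : c.Positive) {ι : Type*} [Fintype ι] [DecidableEq ι] (a b : ι → ℂ)
    (ha : ∀ i j, i ≠ j → c.s (a i - a j) ≠ 0)
    (hab : ∀ r a', c = .elliptic r a' → ∑ j, (a j - b j) = 0) :
    ∑ i, (∏ j, c.s (a i - b j)) / ∏ j ∈ Finset.univ.erase i, c.s (a i - a j) =
      c.s (∑ j, (a j - b j)) := by
  match c, hc with
  | .rational, _ => exact sum_id a b ha
  | .trigonometric r, hr =>
    simp only [trigonometric_s_eq] at *
    exact sum_sin (ofReal_ne_zero.2 (ne_of_gt hr)) a b ha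
  | .hyperbolic a', ha' =>
    simp only [hyperbolic_s_eq] at *
    exact sum_sin (div_ne_zero (mul_ne_zero I_ne_zero (ofReal_ne_zero.2 Real.pi_ne_zero))
      (ofReal_ne_zero.2 (ne_of_gt ha'))) a b ha
  | .elliptic r a', h =>
    have hs := isSigmaLike_elliptic h.1 h.2
    rw [hs.balanced_sum a b ha (hab r a' rfl), hab r a' rfl, hs.zero]

/-- The sum identity with independent index types for the poles and the zeros. -/
theorem sum_eq' (hc : c.Positive) {ι κ : Type*} [Fintype ι] [DecidableEq ι] [Fintype κ]
    (hcard : Fintype.card ι = Fintype.card κ) (a : ι → ℂ) (b : κ → ℂ)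
    (ha : ∀ i j, i ≠ j → c.s (a i - a j) ≠ 0)
    (hab : ∀ r a', c = .elliptic r a' → ∑ j, a j - ∑ j, b j = 0) :
    ∑ i, (∏ j, c.s (a i - b j)) / ∏ j ∈ Finset.univ.erase i, c.s (a i - a j) =
      c.s (∑ j, a j - ∑ j, b j) := by
  let e := Fintype.equivOfCardEq hcard
  have h1 : ∑ j, (a j - b (e j)) = ∑ j, a j - ∑ j, b j := by
    rw [Finset.sum_sub_distrib, e.sum_comp]
  have h := sum_eq hc a (fun j => b (e j)) ha (by rwa [h1])
  rw [h1] at h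
  rw [← h]
  exact Finset.sum_congr rfl fun i _ => by rw [e.prod_comp fun j => c.s (a i - b j)]

theorem hyperbolic_half_shift {a : ℝ} (ha : 0 < a) (z : ℂ) :
    (SCase.hyperbolic a).s (z + I * a) = -(SCase.hyperbolic a).s z := by
  have ha' : (a : ℂ) ≠ 0 := ofReal_ne_zero.2 ha.ne'
  simp only [SCase.s]
  rw [show Real.pi * (z + I * a) / a = Real.pi * z / a + Real.pi * I by field_simp, sinh_add_pi_mul_I]
  ring

theorem trigonometric_half_shift {r : ℝ} (hr : 0 < r) (z : ℂ) :
    (SCase.trigonometric r).s (z + Real.pi / r) = -(SCase.trigonometric r).s z := by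
  have hr' : (r : ℂ) ≠ 0 := ofReal_ne_zero.2 hr.ne'
  simp only [SCase.s]
  rw [show r * (z + Real.pi / r) = r * z + Real.pi by field_simp, sin_add_pi]
  ring

/-- This is quasi-periodicity centred at the midpoint: the constant in the exponent disappears, and
the multiplier in z is governed by ξ_ν alone. -/
theorem add_half_omega (hc : c.Positive) {ν : ℕ} (hν : ν ≤ c.rho) (z : ℂ) :
    c.s (z + c.omega ν / 2) =
      (if ν = 0 then 1 else -1) * exp (2 * I * c.rXi ν * z) * c.s (z - c.omega ν / 2) := by
  match c, hc, ν, hν with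
  | .rational, _, 0, _ => simp [omega, rXi]
  | .trigonometric _, _, 0, _ => simp [omega, rXi]
  | .hyperbolic _, _, 0, _ => simp [omega, rXi]
  | .elliptic _ _, _, 0, _ => simp [omega, rXi]
  | .trigonometric r, hr, 1, _ =>
    have := trigonometric_half_shift hr (z - Real.pi / r / 2)
    rw [show z - Real.pi / r / 2 + Real.pi / r = z + Real.pi / r / 2 by ring] at this
    simpa [omega, rXi] using this
  | .hyperbolic a, ha, 1, _ =>
    have := hyperbolic_half_shift ha (z - I * a / 2)
    rw [show z - I * a / 2 + I * a = z + I * a / 2 by ring] at this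
    simpa [omega, rXi] using this
  | .elliptic r a, h, 1, _ =>
    have := elliptic_s_add_omega_one h.1 h.2 (z - Real.pi / r / 2)
    rw [show z - Real.pi / r / 2 + Real.pi / r = z + Real.pi / r / 2 by ring] at this
    simpa [omega, rXi] using this
  | .elliptic r a, h, 2, _ =>
    have := elliptic_s_add_omega_two h.1 h.2 (z - I * a / 2)
    rw [show z - I * a / 2 + I * a = z + I * a / 2 by ring,
      show r * a - 2 * I * r * (z - I * a / 2) = -(2 * I * r * z) by ring_nf; rw [I_sq]; ring] at this
    simpa [omega, rXi] using this
  | .elliptic r a, h, 3, _ =>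
    have hr' : (r : ℂ) ≠ 0 := ofReal_ne_zero.2 h.1.ne'
    have h1 := elliptic_s_add_omega_one h.1 h.2 (z + (-(Real.pi / r) - I * a) / 2)
    have h2 := elliptic_s_add_omega_two h.1 h.2 (z + (-(Real.pi / r) - I * a) / 2 + Real.pi / r)
    rw [show z + (-(Real.pi / r) - I * a) / 2 + Real.pi / r + I * a = z - (-(Real.pi / r) - I * a) / 2 by ring,
      show r * a - 2 * I * r * (z + (-(Real.pi / r) - I * a) / 2 + Real.pi / r) =
        -(2 * I * r * z) - Real.pi * I by field_simp; ring_nf; rw [I_sq]; ring, h1,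
      exp_sub_pi_mul_I] at h2
    have h3 : exp (2 * I * r * z) * exp (-(2 * I * r * z)) = 1 := by
      rw [← exp_add, add_neg_cancel, exp_zero]
    simp only [omega, rXi]
    rw [h2, if_neg (by norm_num)]
    linear_combination -(SCase.elliptic r a).s (z + (-(Real.pi / r) - I * a) / 2) * h3

/-- A zero would be a lattice point, but some coordinate of a half difference is an odd multiple of
half a basic period. -/
theorem half_omega_sub_ne_zero (hc : c.Positive) {μ ν : ℕ} (hμ : μ ≤ c.rho) (hν : ν ≤ c.rho)
    (hne : ν ≠ μ) : c.s ((c.omega ν - c.omega μ) / 2) ≠ 0 := by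
  wlog hlt : μ < ν generalizing μ ν
  · have := this hν hμ hne.symm (by omega)
    rw [← neg_ne_zero, ← (isSigmaLike hc).odd]
    convert this using 2
    ring
  match c, hc, ν, μ, hν, hlt with
  | .rational, _, ν, μ, hν, hlt =>
    have hν' : ν ≤ 0 := hν
    omega
  | .trigonometric r, hr, 1, 0, _, _ =>
    have hr' : (r : ℂ) ≠ 0 := ofReal_ne_zero.2 (ne_of_gt hr)
    simp only [omega, s, sub_zero]
    rw [show (r : ℂ) * (Real.pi / r / 2) = Real.pi / 2 by field_simp, sin_pi_div_two]
    simpa using hr'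
  | .hyperbolic a, ha, 1, 0, _, _ =>
    have ha' : (a : ℂ) ≠ 0 := ofReal_ne_zero.2 (ne_of_gt ha)
    have hπ : (Real.pi : ℂ) ≠ 0 := ofReal_ne_zero.2 Real.pi_ne_zero
    simp only [omega, s, sub_zero]
    rw [show Real.pi * (I * a / 2) / a = Real.pi / 2 * I by field_simp, sinh_mul_I, sin_pi_div_two]
    simp [ha', hπ]
  | .elliptic r a, h, ν, μ, hν, hlt =>
    intro h0
    obtain ⟨m, n, hmn⟩ := elliptic_s_eq_zero h.1 h.2 h0
    have hre := congrArg re hmn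
    have him := congrArg im hmn
    have hπ : (Real.pi / r : ℂ) = ((Real.pi / r : ℝ) : ℂ) := by push_cast; rfl
    have hb : 0 < Real.pi / r := div_pos Real.pi_pos h.1
    have ha := h.2
    have key : ∀ (x : ℝ), 0 < x → ∀ (k l : ℤ), (k : ℝ) * x / 2 = l * x → k = 2 * l := by
      intro x hx k l hkl
      have : (k : ℝ) = 2 * l := by
        apply mul_right_cancel₀ hx.ne'
        linarith
      exact_mod_cast this
    have hν' : ν ≤ 3 := hν
    interval_cases ν <;> interval_cases μ <;> try omega
    all_goals
      simp only [omega, hπ, sub_re, neg_re, ofReal_re, mul_re, I_re, I_im, ofReal_im, zero_re, sub_im, neg_im, mul_im,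
        zero_im, intCast_re, intCast_im, div_ofNat_re, div_ofNat_im, add_re, add_im] at hre him
    · have := key _ hb 1 m (by push_cast; linarith)
      omega
    · have := key _ ha 1 n (by push_cast; linarith)
      omega
    · have := key _ ha 1 n (by push_cast; linarith)
      omega
    · have := key _ ha (-1) n (by push_cast; linarith)
      omega
    · have := key _ ha (-1) n (by push_cast; linarith)
      omega
    · have := key _ hb (-1) m (by push_cast; linarith)
      omega

theorem half_omega_ne_zero (hc : c.Positive) {ν : ℕ} (h0 : 0 < ν) (hν : ν ≤ c.rho) :
    c.s (c.omega ν / 2) ≠ 0 := by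
  have h := half_omega_sub_ne_zero hc (Nat.zero_le _) hν h0.ne'
  have h1 : c.omega 0 = 0 := by cases c <;> rfl
  rwa [h1, sub_zero] at h

/-- The duplication formula. -/
theorem duplication (hc : c.Positive) (w : ℂ) :
    c.s (2 * w) * ∏ ν ∈ Finset.Icc 1 c.rho, c.s (-(c.omega ν / 2)) =
      2 * ∏ ν ∈ Finset.range (c.rho + 1), c.s (w - c.omega ν / 2) := by
  match c, hc with
  | .rational, _ => simp [rho, omega, s]
  | .trigonometric r, hr =>
    have hr' : (r : ℂ) ≠ 0 := ofReal_ne_zero.2 (ne_of_gt hr)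
    simp only [rho, Finset.Icc_self, Finset.prod_singleton, Finset.prod_range_succ,
      Finset.prod_range_zero, omega, s]
    rw [show (r : ℂ) * -(Real.pi / r / 2) = -(Real.pi / 2) by field_simp, sin_neg, sin_pi_div_two,
      show r * (w - Real.pi / r / 2) = r * w - Real.pi / 2 by field_simp, sin_sub_pi_div_two,
      show r * (2 * w) = 2 * (r * w) by ring, sin_two_mul]
    simp only [zero_div, sub_zero]
    ring
  | .hyperbolic a, ha =>
    have ha' : (a : ℂ) ≠ 0 := ofReal_ne_zero.2 (ne_of_gt ha)
    have hπ : (Real.pi : ℂ) ≠ 0 := ofReal_ne_zero.2 Real.pi_ne_zero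
    simp only [rho, Finset.Icc_self, Finset.prod_singleton, Finset.prod_range_succ,
      Finset.prod_range_zero, omega, s]
    rw [show Real.pi * -(I * a / 2) / a = -(Real.pi / 2 * I) by field_simp, sinh_neg, sinh_mul_I,
      sin_pi_div_two, show Real.pi * (w - I * a / 2) / a = Real.pi * w / a - Real.pi / 2 * I by field_simp,
      sinh_sub, cosh_mul_I, sinh_mul_I, sin_pi_div_two, cos_pi_div_two,
      show Real.pi * (2 * w) / a = 2 * (Real.pi * w / a) by ring, sinh_two_mul]
    simp only [zero_div, sub_zero]
    ring
  | .elliptic r a, h =>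
    have hs := isSigmaLike_elliptic h.1 h.2
    have h1 := fun z => add_half_omega (c := .elliptic r a) h (ν := 1) (by simp [rho]) z
    have h2 := fun z => add_half_omega (c := .elliptic r a) h (ν := 2) (by simp [rho]) z
    have h3 := fun z => add_half_omega (c := .elliptic r a) h (ν := 3) (by simp [rho]) z
    have hI : Finset.Icc 1 (SCase.elliptic r a).rho = {1, 2, 3} := rfl
    have h0 : (SCase.elliptic r a).omega 0 = 0 := rfl
    have h123 : (SCase.elliptic r a).omega 3 = -(SCase.elliptic r a).omega 1 - (SCase.elliptic r a).omega 2 := rfl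
    rw [hI]
    simp only [rho, Finset.prod_range_succ, Finset.prod_range_zero, h0, zero_div, sub_zero, one_mul]
    rw [Finset.prod_insert (by decide), Finset.prod_insert (by decide), Finset.prod_singleton]
    simp only [rXi] at h1 h2 h3
    -- With these arguments the first term is s(2w) s(ω₁/2) s(ω₂/2) s(ω₃/2). Half-period reflection
    -- makes the other two terms equal, because the exponentials for ω₂ and ω₃ cancel; this is the
    -- origin of the factor 2.
    have h12 := hs.three_term (w + (SCase.elliptic r a).omega 1 / 4) (w - (SCase.elliptic r a).omega 1 / 4)
      (-(SCase.elliptic r a).omega 1 / 4) 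
      (((SCase.elliptic r a).omega 2 - (SCase.elliptic r a).omega 3) / 4)
    have E1 := h1 w
    have E2 := h2 w
    have E3 := h3 w
    rw [if_neg (by norm_num)] at E1 E2 E3
    rw [h123] at *
    generalize (SCase.elliptic r a).omega 1 = A at *
    generalize (SCase.elliptic r a).omega 2 = B at *
    generalize (SCase.elliptic r a).s = s at *
    have hexp : exp (2 * I * (-r : ℝ) * w) * exp (2 * I * r * w) = 1 := by
      rw [← exp_add, ← exp_zero]; push_cast; ring_nf
    rw [ofReal_zero, mul_zero, zero_mul, exp_zero] at E1
    rw [show w + A / 4 + (w - A / 4) = 2 * w by ring, show w + A / 4 - (w - A / 4) = A / 2 by ring,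
      show -A / 4 + (B - (-A - B)) / 4 = B / 2 by ring,
      show -A / 4 - (B - (-A - B)) / 4 = (-A - B) / 2 by ring,
      show w + A / 4 + -A / 4 = w by ring, show w + A / 4 - -A / 4 = w + A / 2 by ring,
      show (B - (-A - B)) / 4 + (w - A / 4) = w + B / 2 by ring,
      show (B - (-A - B)) / 4 - (w - A / 4) = -(w + (-A - B) / 2) by ring,
      show w + A / 4 + (B - (-A - B)) / 4 = w - (-A - B) / 2 by ring,
      show w + A / 4 - (B - (-A - B)) / 4 = w - B / 2 by ring,
      show w - A / 4 + -A / 4 = w - A / 2 by ring, show w - A / 4 - -A / 4 = w by ring,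
      hs.odd, E1, E2, E3] at h12
    rw [hs.odd, hs.odd, hs.odd]
    linear_combination -h12 + s w * s (w - A / 2) * s (w - B / 2) * s (w - (-A - B) / 2) * hexp

end SCase

/-! ### Splitting products over poles and signs -/

theorem prod_erase_inl {α β M : Type*} [Fintype α] [Fintype β] [DecidableEq α] [DecidableEq β]
    [CommMonoid M] (i : α) (f : α ⊕ β → M) :
    ∏ k ∈ Finset.univ.erase (Sum.inl i), f k =
      (∏ k ∈ Finset.univ.erase i, f (.inl k)) * ∏ k, f (.inr k) := by
  rw [← Finset.prod_disjSum]
  congr 1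
  ext (k | k) <;> simp

theorem prod_erase_inr {α β M : Type*} [Fintype α] [Fintype β] [DecidableEq α] [DecidableEq β]
    [CommMonoid M] (i : β) (f : α ⊕ β → M) :
    ∏ k ∈ Finset.univ.erase (Sum.inr i), f k =
      (∏ k, f (.inl k)) * ∏ k ∈ Finset.univ.erase i, f (.inr k) := by
  rw [← Finset.prod_disjSum]
  congr 1
  ext (k | k) <;> simp

theorem prod_units {M : Type*} [CommMonoid M] (f : ℤˣ → M) (ε : ℤˣ) :
    ∏ δ, f δ = f ε * f (-ε) := by
  rcases Int.units_eq_one_or ε with rfl | rfl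
  · simp [UnitsInt.univ]
  · simp [UnitsInt.univ, mul_comm]

/-- For the pole ε x_j, this isolates its mirror image -ε x_j and groups the other particles by sign
pairs. -/
theorem prod_units_prod_erase {N : ℕ} {M : Type*} [CommMonoid M] (ε : ℤˣ) (j : Fin N)
    (f : ℤˣ × Fin N → M) :
    ∏ p ∈ Finset.univ.erase (ε, j), f p =
      f (-ε, j) * ∏ k ∈ Finset.univ.erase j, ∏ δ, f (δ, k) := by
  rw [Finset.prod_comm, ← Finset.prod_product',
    ← Finset.prod_insert (s := Finset.univ ×ˢ Finset.univ.erase j) (by simp)]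
  congr 1
  ext ⟨δ, k⟩
  have := Int.units_ne_iff_eq_neg (u := δ) (v := ε)
  simp only [Finset.mem_erase, ne_eq, Prod.mk.injEq, Finset.mem_univ, and_true, Finset.mem_insert,
    Finset.mem_product, true_and]
  have h2 : ε ≠ -ε := by rcases Int.units_eq_one_or ε with rfl | rfl <;> decide
  grind

theorem prod_range_erase {n : ℕ} {M : Type*} [CommMonoid M] (ν : Fin n) (f : ℕ → M) :
    ∏ μ ∈ (Finset.range n).erase ν, f μ = ∏ μ ∈ Finset.univ.erase ν, f μ := by
  have : (Finset.range n).erase ν = (Finset.univ.erase ν).map Fin.valEmbedding := by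
    ext k
    simp only [Finset.mem_erase, Finset.mem_range, Finset.mem_map, Finset.mem_univ, and_true,
      Fin.valEmbedding_apply]
    constructor
    · rintro ⟨h1, h2⟩
      exact ⟨⟨k, h2⟩, fun h => h1 (by rw [← h]), rfl⟩
    · rintro ⟨m, h1, rfl⟩
      exact ⟨fun h => h1 (Fin.ext h), m.2⟩
  rw [this, Finset.prod_map]
  rfl

theorem sum_add_sum_add_sum_congr {α β γ M : Type*} [Fintype α] [Fintype β] [Fintype γ]
    [AddCommMonoid M] {f f' : α → M} {g g' : β → M} {h h' : γ → M} {m : M}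
    (hf : ∀ i, f i = f' i) (hg : ∀ i, g i = g' i) (hh : ∀ i, h i = h' i)
    (H : ∑ i, f i + (∑ i, g i + ∑ i, h i) = m) :
    ∑ i, f' i + (∑ i, g' i + ∑ i, h' i) = m := by
  rw [← H, funext hf, funext hg, funext hh]

/-! ### The summands of the residue identity -/

section Identity

variable {c : SCase} (hc : c.Positive) {N : ℕ} (g : Fin (2 * c.rho + 2) → ℝ) (lam β : ℝ)

/-- With ρ = 3 the bracket is 2λ(N - 1) + |g| - 2, the balancing expression; outside the elliptic
case the factor `c.rXi ν` vanishes. -/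
theorem rXi_mul_balance
    (hbal : ∀ r a : ℝ, c = .elliptic r a → 2 * lam * ((N : ℝ) - 1) + ∑ ν, g ν - 2 = 0) (ν : ℕ) :
    c.rXi ν * (2 * lam * N + gSum c g - (c.rho + 1) * (lam + 1) / 2) = 0 := by
  match c with
  | .rational => simp [SCase.rXi]
  | .trigonometric _ => simp [SCase.rXi]
  | .hyperbolic _ => simp [SCase.rXi]
  | .elliptic r a =>
    have := hbal r a rfl
    have h3 : ((SCase.elliptic r a).rho : ℝ) = 3 := by norm_num [SCase.rho]
    rw [h3, gSum, mul_eq_zero]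
    right
    linarith

/-- The contribution of the pole iβ/2 + ω_ν/2 is a summand of V⁰; the exponential written there
equals 1 by balancing. -/
theorem term_half_omega (x : Fin N → ℂ)
    (hbal : ∀ r a : ℝ, c = .elliptic r a → 2 * lam * ((N : ℝ) - 1) + ∑ ν, g ν - 2 = 0)
    (ν : Fin (c.rho + 1)) :
    ((∏ p : ℤˣ × Fin N, c.s (I * β / 2 + c.omega ν / 2 - (I * lam * β - sgn p.1 * x p.2))) *
        ∏ μ, c.s (I * β / 2 + c.omega ν / 2 - I * g μ * β)) /
      ((∏ p : ℤˣ × Fin N, c.s (I * β / 2 + c.omega ν / 2 - sgn p.1 * x p.2)) *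
        ((∏ μ ∈ Finset.univ.erase ν,
            c.s (I * β / 2 + c.omega ν / 2 - (I * β / 2 + c.omega μ / 2))) *
          ∏ μ : Fin (c.rho + 1),
            c.s (I * β / 2 + c.omega ν / 2 - (I * lam * β / 2 + c.omega μ / 2)))) =
    exp (-(c.rXi ν * (2 * lam * N + gSum c g - (c.rho + 1) * (lam + 1) / 2) * β)) /
      (∏ μ ∈ (Finset.range (c.rho + 1)).erase ν, c.s ((c.omega ν - c.omega μ) / 2)) *
    ((∏ μ, c.s (c.omega ν / 2 + I * β / 2 - I * g μ * β)) /
      ∏ μ ∈ Finset.range (c.rho + 1), c.s ((c.omega ν - c.omega μ + I * (1 - lam) * β) / 2)) *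
    ∏ δ : ℤˣ, ∏ j : Fin N,
      c.s (sgn δ * x j + c.omega ν / 2 + I * β / 2 - I * lam * β) /
        c.s (sgn δ * x j + c.omega ν / 2 + I * β / 2) := by
  have h0 := congrArg (fun y : ℝ => (y : ℂ)) (rXi_mul_balance (N := N) g lam hbal ν)
  push_cast at h0
  rw [h0, zero_mul, neg_zero, exp_zero, prod_range_erase ν (fun μ => c.s ((c.omega ν - c.omega μ) / 2)),
    Finset.prod_range]
  simp only [Finset.prod_div_distrib]
  have h1 : ∏ p : ℤˣ × Fin N, c.s (I * β / 2 + c.omega ν / 2 - sgn p.1 * x p.2) =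
      ∏ δ : ℤˣ, ∏ j : Fin N, c.s (sgn δ * x j + c.omega ν / 2 + I * β / 2) := by
    -- The pole factors carry -δ x_j where V⁰ has +δ x_j, so the sign is reindexed.
    rw [Fintype.prod_prod_type, ← Equiv.prod_comp (Equiv.neg ℤˣ)]
    refine Finset.prod_congr rfl fun δ _ => Finset.prod_congr rfl fun j _ => ?_
    congr 1
    simp [sgn]
    ring
  have h2 : ∏ p : ℤˣ × Fin N, c.s (I * β / 2 + c.omega ν / 2 - (I * lam * β - sgn p.1 * x p.2)) =
      ∏ δ : ℤˣ, ∏ j : Fin N, c.s (sgn δ * x j + c.omega ν / 2 + I * β / 2 - I * lam * β) := by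
    rw [Fintype.prod_prod_type]
    refine Finset.prod_congr rfl fun δ _ => Finset.prod_congr rfl fun j _ => ?_
    congr 1
    ring
  have h3 : ∀ μ : ℕ, I * β / 2 + c.omega ν / 2 - (I * β / 2 + c.omega μ / 2) =
      (c.omega ν - c.omega μ) / 2 := fun μ => by ring
  have h4 : ∀ μ : ℕ, I * β / 2 + c.omega ν / 2 - (I * lam * β / 2 + c.omega μ / 2) =
      (c.omega ν - c.omega μ + I * (1 - lam) * β) / 2 := fun μ => by ring
  simp only [h1, h2, h3, h4]
  rw [add_comm (I * β / 2) (c.omega ν / 2)]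
  ring

include hc

/-- The product over one pole and the poles obtained from it by adding half periods. -/
theorem prod_sub_half_omega (w : ℂ) :
    ∏ ν : Fin (c.rho + 1), c.s (w - c.omega ν / 2) =
      c.s (2 * w) * (∏ ν ∈ Finset.Icc 1 c.rho, c.s (-(c.omega ν / 2))) / 2 := by
  rw [SCase.duplication hc, Finset.prod_range]
  ring

theorem prefactor_eq :
    c.prefactor = (∏ ν ∈ Finset.Icc 1 c.rho, c.s (-(c.omega ν / 2))) ^ 2 / 4 := by
  rw [SCase.prefactor, ← Finset.prod_pow]
  congr 1
  exact Finset.prod_congr rfl fun ν _ => by rw [(SCase.isSigmaLike hc).odd, neg_sq]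

theorem prod_half_omega_ne_zero : ∏ ν ∈ Finset.Icc 1 c.rho, c.s (-(c.omega ν / 2)) ≠ 0 :=
  Finset.prod_ne_zero_iff.2 fun ν hν => by
    rw [(SCase.isSigmaLike hc).odd]
    rw [Finset.mem_Icc] at hν
    exact neg_ne_zero.2 (SCase.half_omega_ne_zero hc hν.1 hν.2)

theorem sub_half_omega_ne_zero {w : ℂ} (hw : c.s (2 * w) ≠ 0) {ν : ℕ} (hν : ν ≤ c.rho) :
    c.s (w - c.omega ν / 2) ≠ 0 := by
  intro h
  have h1 := prod_sub_half_omega hc w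
  rw [Finset.prod_eq_zero (Finset.mem_univ (⟨ν, by omega⟩ : Fin (c.rho + 1))) h] at h1
  have h2 := mul_ne_zero hw (prod_half_omega_ne_zero hc)
  exact h2 (by linear_combination -2 * h1)

theorem pair_ratio (ε : ℤˣ) (X Y L : ℂ) :
    (∏ δ : ℤˣ, c.s (sgn ε * X - (L - sgn δ * Y))) / ∏ δ : ℤˣ, c.s (sgn ε * X - sgn δ * Y) =
      ∏ δ : ℤˣ, c.s (X + sgn δ * Y - sgn ε * L) / c.s (X + sgn δ * Y) := by
  have hs := SCase.isSigmaLike hc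
  simp only [prod_units _ (1 : ℤˣ)]
  rcases Int.units_eq_one_or ε with rfl | rfl
  · simp [sgn]
    rw [show X - (L - Y) = X + Y - L by ring, show X - (L + Y) = X + -Y - L by ring,
      ← sub_eq_add_neg]
    ring
  · simp [sgn]
    rw [show -X - (L - Y) = -(X + -Y + L) by ring, show -X - (L + Y) = -(X + Y + L) by ring,
      show -X - Y = -(X + Y) by ring, show -X + Y = -(X + -Y) by ring, hs.odd, hs.odd, hs.odd,
      hs.odd]
    ring

/-- The zeros attached to (ε, j) and (-ε, j) give s(2εx_j - iλβ) and -s(iλβ). By duplication the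
former cancels against the auxiliary poles iλβ/2 + ω_ν/2, while the poles iβ/2 + ω_ν/2 give s(2εx_j
- iβ). The two uses of duplication produce the prefactor. -/
theorem term_particle (x : Fin N → ℂ) (ε : ℤˣ) (j : Fin N)
    (hq : c.s (2 * (sgn ε * x j - I * lam * β / 2)) ≠ 0) :
    ((∏ p : ℤˣ × Fin N, c.s (sgn ε * x j - (I * lam * β - sgn p.1 * x p.2))) *
        ∏ ν, c.s (sgn ε * x j - I * g ν * β)) /
      ((∏ p ∈ Finset.univ.erase (ε, j), c.s (sgn ε * x j - sgn p.1 * x p.2)) *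
        ((∏ ν : Fin (c.rho + 1), c.s (sgn ε * x j - (I * β / 2 + c.omega ν / 2))) *
         ∏ ν : Fin (c.rho + 1), c.s (sgn ε * x j - (I * lam * β / 2 + c.omega ν / 2)))) =
      -(c.s (I * lam * β) * V c g lam β ε j x) / c.prefactor := by
  have hs := SCase.isSigmaLike hc
  have hD := prod_half_omega_ne_zero hc
  simp only [← sub_sub]
  rw [prod_sub_half_omega hc, prod_sub_half_omega hc, prefactor_eq hc, prod_units_prod_erase]
  have h1 : ∏ p : ℤˣ × Fin N, c.s (sgn ε * x j - (I * lam * β - sgn p.1 * x p.2)) =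
      c.s (2 * (sgn ε * x j - I * lam * β / 2)) * (-c.s (I * lam * β) *
        ∏ k ∈ Finset.univ.erase j, ∏ δ : ℤˣ, c.s (sgn ε * x j - (I * lam * β - sgn δ * x k))) := by
    rw [← Finset.mul_prod_erase _ _ (Finset.mem_univ (ε, j)), prod_units_prod_erase, ← hs.odd]
    congr 2
    · ring_nf
    · congr 1
      simp [sgn]
  have h2 : V c g lam β ε j x = (∏ ν, c.s (sgn ε * x j - I * g ν * β)) /
      (c.s (2 * (sgn ε * x j)) * c.s (2 * (sgn ε * x j - I * β / 2))) *
      ((∏ k ∈ Finset.univ.erase j, ∏ δ : ℤˣ, c.s (sgn ε * x j - (I * lam * β - sgn δ * x k))) /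
        ∏ k ∈ Finset.univ.erase j, ∏ δ : ℤˣ, c.s (sgn ε * x j - sgn δ * x k)) := by
    rw [V, Finset.prod_comm, ← Finset.prod_div_distrib]
    congr 1
    · congr 3 <;> ring
    · refine Finset.prod_congr rfl fun k _ => ?_
      rw [pair_ratio hc]
      refine Finset.prod_congr rfl fun δ _ => ?_
      congr 2
      ring
  rw [h1, h2, show sgn ε * x j - sgn (-ε) * x j = 2 * (sgn ε * x j) by simp [sgn]; ring]
  generalize ∏ k ∈ Finset.univ.erase j, ∏ δ : ℤˣ, c.s (sgn ε * x j - (I * lam * β - sgn δ * x k)) = A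
  generalize ∏ k ∈ Finset.univ.erase j, ∏ δ : ℤˣ, c.s (sgn ε * x j - sgn δ * x k) = B
  generalize c.s (2 * (sgn ε * x j - I * lam * β / 2)) = Q at *
  generalize c.s (2 * (sgn ε * x j - I * β / 2)) = P
  generalize c.s (2 * (sgn ε * x j)) = R
  field_simp
  ring

/-- At this pole, half-period reflection turns each zero factor into a pole factor times an
exponential. For the two signs of x_j the x-dependent parts of the exponents cancel. The hypothesis
`hx` excludes quotients 0/0. -/
theorem half_omega_ratio (x : Fin N → ℂ) {ν : ℕ} (hν : ν ≤ c.rho)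
    (hx : ∀ j, ∀ ε : ℤˣ, c.s (sgn ε * x j - I * lam * β / 2 - c.omega ν / 2) ≠ 0) :
    (∏ p : ℤˣ × Fin N, c.s (I * lam * β / 2 + c.omega ν / 2 - (I * lam * β - sgn p.1 * x p.2))) /
      (∏ p : ℤˣ × Fin N, c.s (I * lam * β / 2 + c.omega ν / 2 - sgn p.1 * x p.2)) =
    exp (c.rXi ν * (2 * lam * N) * β) := by
  have hs := SCase.isSigmaLike hc
  rw [← Finset.prod_div_distrib, Fintype.prod_prod_type, Finset.prod_comm]
  have h1 : ∀ (j : Fin N) (δ : ℤˣ),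
      c.s (I * lam * β / 2 + c.omega ν / 2 - (I * lam * β - sgn δ * x j)) /
        c.s (I * lam * β / 2 + c.omega ν / 2 - sgn δ * x j) =
      -(if ν = 0 then 1 else -1) * exp (2 * I * c.rXi ν * (sgn δ * x j - I * lam * β / 2)) := by
    intro j δ
    have h2 := SCase.add_half_omega hc hν (sgn δ * x j - I * lam * β / 2)
    rw [show I * lam * β / 2 + c.omega ν / 2 - (I * lam * β - sgn δ * x j) =
      sgn δ * x j - I * lam * β / 2 + c.omega ν / 2 by ring, h2,
      show I * lam * β / 2 + c.omega ν / 2 - sgn δ * x j =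
        -(sgn δ * x j - I * lam * β / 2 - c.omega ν / 2) by ring, hs.odd]
    rw [div_eq_iff (neg_ne_zero.2 (hx j δ))]
    ring
  have h2 : ∀ j : Fin N, ∏ δ : ℤˣ,
      c.s (I * lam * β / 2 + c.omega ν / 2 - (I * lam * β - sgn δ * x j)) /
        c.s (I * lam * β / 2 + c.omega ν / 2 - sgn δ * x j) = exp (c.rXi ν * (2 * lam) * β) := by
    intro j
    rw [prod_units _ (1 : ℤˣ), h1, h1]
    have e : exp (c.rXi ν * (2 * lam) * β) =
        exp (2 * I * c.rXi ν * (sgn 1 * x j - I * lam * β / 2)) *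
        exp (2 * I * c.rXi ν * (sgn (-1) * x j - I * lam * β / 2)) := by
      rw [← exp_add]
      congr 1
      simp [sgn]
      linear_combination (2 * c.rXi ν * lam * β : ℂ) * I_sq
    rw [e]
    split_ifs <;> ring
  rw [Finset.prod_congr rfl fun j _ => h2 j, Finset.prod_const, Finset.card_univ, Fintype.card_fin,
    ← exp_nat_mul]
  ring_nf

/-- The contribution of an auxiliary pole is a summand of c⁰: balancing identifies the exponential
left over from the reflections with the one in c⁰. -/
theorem term_half_omega_lam (x : Fin N → ℂ)
    (hbal : ∀ r a : ℝ, c = .elliptic r a → 2 * lam * ((N : ℝ) - 1) + ∑ ν, g ν - 2 = 0)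
    (ν : Fin (c.rho + 1))
    (hx : ∀ j, ∀ ε : ℤˣ, c.s (sgn ε * x j - I * lam * β / 2 - c.omega ν / 2) ≠ 0) :
    ((∏ p : ℤˣ × Fin N, c.s (I * lam * β / 2 + c.omega ν / 2 - (I * lam * β - sgn p.1 * x p.2))) *
        ∏ μ, c.s (I * lam * β / 2 + c.omega ν / 2 - I * g μ * β)) /
      ((∏ p : ℤˣ × Fin N, c.s (I * lam * β / 2 + c.omega ν / 2 - sgn p.1 * x p.2)) *
        ((∏ μ : Fin (c.rho + 1),
            c.s (I * lam * β / 2 + c.omega ν / 2 - (I * β / 2 + c.omega μ / 2))) *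
          ∏ μ ∈ Finset.univ.erase ν,
            c.s (I * lam * β / 2 + c.omega ν / 2 - (I * lam * β / 2 + c.omega μ / 2)))) =
    exp (-(c.rXi ν * (gSum c g - (c.rho + 1) * (lam + 1) / 2) * β)) /
      (∏ μ ∈ (Finset.range (c.rho + 1)).erase ν, c.s ((c.omega ν - c.omega μ) / 2)) *
    ((∏ μ, c.s (c.omega ν / 2 + I * lam * β / 2 - I * g μ * β)) /
      ∏ μ ∈ Finset.range (c.rho + 1), c.s ((c.omega ν - c.omega μ + I * (lam - 1) * β) / 2)) := by
  have h0 := congrArg (fun y : ℝ => (y : ℂ)) (rXi_mul_balance (N := N) g lam hbal ν)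
  push_cast at h0
  have h1 := half_omega_ratio hc lam β x (Nat.lt_succ_iff.1 ν.2) hx
  have h2 : exp (-(c.rXi ν * (gSum c g - (c.rho + 1) * (lam + 1) / 2) * β)) =
      exp (c.rXi ν * (2 * lam * N) * β) := by
    congr 1
    linear_combination -(β : ℂ) * h0
  have h3 : ∀ μ : ℕ, I * lam * β / 2 + c.omega ν / 2 - (I * lam * β / 2 + c.omega μ / 2) =
      (c.omega ν - c.omega μ) / 2 := fun μ => by ring
  have h4 : ∀ μ : ℕ, I * lam * β / 2 + c.omega ν / 2 - (I * β / 2 + c.omega μ / 2) =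
      (c.omega ν - c.omega μ + I * (lam - 1) * β) / 2 := fun μ => by ring
  rw [h2, ← h1, prod_range_erase ν (fun μ => c.s ((c.omega ν - c.omega μ) / 2)),
    Finset.prod_range]
  simp only [h3, h4]
  rw [add_comm (I * lam * β / 2) (c.omega ν / 2)]
  ring

/-- The eigenvalue identity, away from the zeros of `s(± x_j - iλβ/2 - ω_ν/2)`. -/
theorem sum_V_add_V0_generic
    (hlam : ∀ ν ≤ c.rho, ∀ μ ≤ c.rho, c.s ((c.omega ν - c.omega μ + I * (lam - 1) * β) / 2) ≠ 0)
    (hbal : ∀ r a : ℝ, c = .elliptic r a → 2 * lam * ((N : ℝ) - 1) + ∑ ν, g ν - 2 = 0)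
    (x : Fin N → ℂ) (h1 : ∀ j, c.s (2 * x j) ≠ 0)
    (h2 : ∀ j, ∀ ε : ℤˣ, c.s (2 * x j + sgn ε * I * β) ≠ 0)
    (h3 : ∀ j k, j ≠ k → ∀ ε : ℤˣ, c.s (x j + sgn ε * x k) ≠ 0)
    (h4 : ∀ j, ∀ ε : ℤˣ, c.s (2 * (sgn ε * x j - I * lam * β / 2)) ≠ 0) :
    c.s (I * lam * β) * ∑ ε : ℤˣ, ∑ j, V c g lam β ε j x + V0 c g lam β x =
      eigenvalue c g lam β N := by
  have hs := SCase.isSigmaLike hc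
  have hsym : ∀ {u v}, c.s (u - v) ≠ 0 → c.s (v - u) ≠ 0 := fun h => by
    rw [hs.sub_comm]; exact neg_ne_zero.2 h
  have h4' := fun j ε ν hν => sub_half_omega_ne_zero hc (h4 j ε) (ν := ν) hν
  have hsgn : ∀ (ε : ℤˣ) (u : ℂ), c.s u ≠ 0 → c.s (sgn ε * u) ≠ 0 := by
    intro ε u hu
    rcases Int.units_eq_one_or ε with rfl | rfl <;> simpa [sgn, hs.odd] using hu
  have h2' : ∀ j (ε : ℤˣ) ν, ν ≤ c.rho → c.s (sgn ε * x j - I * β / 2 - c.omega ν / 2) ≠ 0 := by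
    intro j ε ν hν
    refine sub_half_omega_ne_zero hc ?_ hν
    convert hsgn ε _ (h2 j (-ε)) using 2
    rcases Int.units_eq_one_or ε with rfl | rfl <;> simp [sgn] <;> ring
  -- `A` lists the poles and `B` the zeros: 2N + 2(ρ + 1) of each. The last family of poles is
  -- auxiliary, which is why `h4` is needed here although V and V⁰ are regular at those x.
  let A : (ℤˣ × Fin N) ⊕ (Fin (c.rho + 1) ⊕ Fin (c.rho + 1)) → ℂ :=
    Sum.elim (fun p => sgn p.1 * x p.2) (Sum.elim (fun ν => I * β / 2 + c.omega ν / 2)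
      fun ν => I * lam * β / 2 + c.omega ν / 2)
  let B : (ℤˣ × Fin N) ⊕ Fin (2 * c.rho + 2) → ℂ :=
    Sum.elim (fun p => I * lam * β - sgn p.1 * x p.2) fun ν => I * g ν * β
  have hA : ∀ i j, i ≠ j → c.s (A i - A j) ≠ 0 := by
    have pp : ∀ p q : ℤˣ × Fin N, p ≠ q → c.s (sgn p.1 * x p.2 - sgn q.1 * x q.2) ≠ 0 := by
      rintro ⟨ε, j⟩ ⟨δ, k⟩ hne
      by_cases hjk : j = k
      · subst hjk
        have hδ : δ = -ε := Int.units_ne_iff_eq_neg.1 fun h => hne (by rw [h])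
        convert hsgn ε _ (h1 j) using 2
        simp [hδ, sgn]
        ring
      · convert hsgn ε _ (h3 j k hjk (-(ε * δ))) using 2
        rcases Int.units_eq_one_or ε with rfl | rfl <;>
          rcases Int.units_eq_one_or δ with rfl | rfl <;> simp [sgn] <;> ring
    have oo : ∀ ν μ : Fin (c.rho + 1), ν ≠ μ → c.s ((c.omega ν - c.omega μ) / 2) ≠ 0 :=
      fun ν μ h => SCase.half_omega_sub_ne_zero hc (Nat.lt_succ_iff.1 μ.2) (Nat.lt_succ_iff.1 ν.2)
        fun h' => h (Fin.ext h')
    have pq : ∀ ν μ : Fin (c.rho + 1),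
        c.s (I * lam * β / 2 + c.omega ν / 2 - (I * β / 2 + c.omega μ / 2)) ≠ 0 := by
      intro ν μ
      convert hlam ν (Nat.lt_succ_iff.1 ν.2) μ (Nat.lt_succ_iff.1 μ.2) using 2
      ring
    have xp : ∀ (p : ℤˣ × Fin N) (ν : Fin (c.rho + 1)),
        c.s (sgn p.1 * x p.2 - (I * β / 2 + c.omega ν / 2)) ≠ 0 := fun p ν => by
      rw [← sub_sub]
      exact h2' p.2 p.1 ν (Nat.lt_succ_iff.1 ν.2)
    have xq : ∀ (p : ℤˣ × Fin N) (ν : Fin (c.rho + 1)),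
        c.s (sgn p.1 * x p.2 - (I * lam * β / 2 + c.omega ν / 2)) ≠ 0 := fun p ν => by
      rw [← sub_sub]
      exact h4' p.2 p.1 ν (Nat.lt_succ_iff.1 ν.2)
    rintro (p | ν | ν) (q | μ | μ) hne
    · exact pp p q fun h => hne (by rw [h])
    · exact xp p μ
    · exact xq p μ
    · exact hsym (xp q ν)
    · convert oo ν μ (fun h => hne (by rw [h])) using 2
      simp only [A, Sum.elim_inl, Sum.elim_inr]
      ring
    · exact hsym (pq μ ν)
    · exact hsym (xq q ν)
    · exact pq ν μ
    · convert oo ν μ (fun h => hne (by rw [h])) using 2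
      simp only [A, Sum.elim_inr]
      ring
  have hzero : ∀ f : Fin N → ℂ, ∑ p : ℤˣ × Fin N, sgn p.1 * f p.2 = 0 := by
    intro f
    rw [Fintype.sum_prod_type]
    simp [UnitsInt.univ, sgn]
  -- The particle positions cancel between the two signs; the half periods occur in two families,
  -- hence |ω| and not |ω|/2.
  have hsum : ∑ i, A i - ∑ i, B i =
      c.omegaSum - I * β * (2 * lam * N + gSum c g - (c.rho + 1) * (lam + 1) / 2) := by
    have e1 : ∑ ν : Fin (c.rho + 1), c.omega ν / 2 = c.omegaSum / 2 := by
      rw [SCase.omegaSum, Finset.sum_range, Finset.sum_div]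
    have e2 : ∑ ν, I * (g ν : ℂ) * β = I * gSum c g * β := by
      rw [gSum, ofReal_sum, Finset.mul_sum, Finset.sum_mul]
    simp only [A, B, Fintype.sum_sum_type, Sum.elim_inl, Sum.elim_inr, Finset.sum_add_distrib,
      Finset.sum_sub_distrib, hzero, e1, e2, Finset.sum_const, Finset.card_univ, Fintype.card_prod,
      Fintype.card_fin, Fintype.card_units_int, nsmul_eq_mul]
    push_cast
    ring
  have hcard : Fintype.card ((ℤˣ × Fin N) ⊕ (Fin (c.rho + 1) ⊕ Fin (c.rho + 1))) =
      Fintype.card ((ℤˣ × Fin N) ⊕ Fin (2 * c.rho + 2)) := by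
    simp only [Fintype.card_sum, Fintype.card_fin]
    ring
  have hrel : ∀ r a', c = .elliptic r a' → ∑ i, A i - ∑ i, B i = 0 := by
    intro r a' hca
    have h0 := congrArg (fun y : ℝ => (y : ℂ)) (hbal r a' hca)
    have e1 : c.omegaSum = 0 := by
      subst hca
      simp [SCase.omegaSum, SCase.rho, SCase.omega, Finset.sum_range_succ]
    have e2 : (c.rho : ℂ) = 3 := by subst hca; norm_num [SCase.rho]
    rw [hsum, e1, e2, gSum]
    push_cast at h0 ⊢
    linear_combination -(I * β) * h0
  have key := SCase.sum_eq' hc hcard A B hA hrel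
  rw [hsum, hs.sub_comm] at key
  simp only [Fintype.sum_sum_type, Fintype.prod_sum_type, prod_erase_inl, prod_erase_inr] at key
  simp only [A, B, Sum.elim_inl, Sum.elim_inr] at key
  have key' := sum_add_sum_add_sum_congr
    (fun p : ℤˣ × Fin N => term_particle hc g lam β x p.1 p.2 (h4 p.2 p.1))
    (fun ν => term_half_omega g lam β x hbal ν)
    (fun ν => term_half_omega_lam hc g lam β x hbal ν
      fun j ε => h4' j ε ν (Nat.lt_succ_iff.1 ν.2)) key
  rw [← Finset.sum_div, Finset.sum_neg_distrib, ← Finset.mul_sum, Fintype.sum_prod_type] at key'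
  have hpre : c.prefactor ≠ 0 := by
    rw [prefactor_eq hc]
    exact div_ne_zero (pow_ne_zero _ (prod_half_omega_ne_zero hc)) (by norm_num)
  rw [eigenvalue, V0, c0, Finset.sum_range, Finset.sum_range]
  have h5 : -(c.s (I * lam * β) * ∑ ε : ℤˣ, ∑ j, V c g lam β ε j x) / c.prefactor * c.prefactor =
      -(c.s (I * lam * β) * ∑ ε : ℤˣ, ∑ j, V c g lam β ε j x) := div_mul_cancel₀ _ hpre
  -- Multiplication by minus the prefactor turns the residue sum into the eigenvalue identity.
  linear_combination -c.prefactor * key' + h5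

end Identity

/-! ### Regularity of the coefficients, and the eigenvalue identity at all regular points -/

section Identity

variable {c : SCase} (hc : c.Positive) {N : ℕ} (g : Fin (2 * c.rho + 2) → ℝ) (lam β : ℝ)
include hc

theorem s_sgn_mul_ne_zero (ε : ℤˣ) {u : ℂ} (hu : c.s u ≠ 0) : c.s (sgn ε * u) ≠ 0 := by
  rcases Int.units_eq_one_or ε with rfl | rfl <;>
    simpa [sgn, (SCase.isSigmaLike hc).odd] using hu

theorem analyticAt_V {x : Fin N → ℂ} (h1 : ∀ j, c.s (2 * x j) ≠ 0)
    (h2 : ∀ j, ∀ ε : ℤˣ, c.s (2 * x j + sgn ε * I * β) ≠ 0)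
    (h3 : ∀ j k, j ≠ k → ∀ ε : ℤˣ, c.s (x j + sgn ε * x k) ≠ 0) (ε : ℤˣ) (j : Fin N) :
    AnalyticAt ℂ (V c g lam β ε j) x := by
  have hs : ∀ z, AnalyticAt ℂ c.s z := fun z => (SCase.isSigmaLike hc).differentiable.analyticAt z
  have hp : ∀ j, AnalyticAt ℂ (fun x : Fin N → ℂ => x j) x := fun j =>
    (ContinuousLinearMap.proj (R := ℂ) (φ := fun _ : Fin N => ℂ) j).analyticAt x
  have hcomp : ∀ {f : (Fin N → ℂ) → ℂ}, AnalyticAt ℂ f x → AnalyticAt ℂ (fun x => c.s (f x)) x :=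
    fun hf => (hs _).fun_comp hf
  refine AnalyticAt.mul (AnalyticAt.div ?_ (AnalyticAt.mul ?_ ?_) (mul_ne_zero ?_ ?_)) ?_
  · exact Finset.analyticAt_fun_prod _ fun ν _ =>
      hcomp ((analyticAt_const.mul (hp j)).sub analyticAt_const)
  · exact hcomp (analyticAt_const.mul (hp j))
  · exact hcomp ((analyticAt_const.mul (hp j)).sub analyticAt_const)
  · rw [mul_assoc]
    exact s_sgn_mul_ne_zero hc ε (h1 j)
  · convert s_sgn_mul_ne_zero hc ε (h2 j (-ε)) using 2
    rcases Int.units_eq_one_or ε with rfl | rfl <;> simp [sgn] <;> ring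
  · refine Finset.analyticAt_fun_prod _ fun δ _ => Finset.analyticAt_fun_prod _ fun k hk => ?_
    have hjk := (hp j).add ((analyticAt_const (v := sgn δ)).mul (hp k))
    exact AnalyticAt.div (hcomp (hjk.sub analyticAt_const)) (hcomp hjk)
      (h3 j k (Finset.ne_of_mem_erase hk).symm δ)

theorem analyticAt_V0 {x : Fin N → ℂ}
    (h2 : ∀ j, ∀ ε : ℤˣ, c.s (2 * x j + sgn ε * I * β) ≠ 0) :
    AnalyticAt ℂ (V0 c g lam β) x := by
  have hs : ∀ z, AnalyticAt ℂ c.s z := fun z => (SCase.isSigmaLike hc).differentiable.analyticAt z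
  have hp : ∀ j, AnalyticAt ℂ (fun x : Fin N → ℂ => x j) x := fun j =>
    (ContinuousLinearMap.proj (R := ℂ) (φ := fun _ : Fin N => ℂ) j).analyticAt x
  have hcomp : ∀ {f : (Fin N → ℂ) → ℂ}, AnalyticAt ℂ f x → AnalyticAt ℂ (fun x => c.s (f x)) x :=
    fun hf => (hs _).fun_comp hf
  refine AnalyticAt.mul analyticAt_const (Finset.analyticAt_fun_sum _ fun ν hν =>
    AnalyticAt.mul analyticAt_const (Finset.analyticAt_fun_prod _ fun δ _ =>
      Finset.analyticAt_fun_prod _ fun j _ => ?_))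
  have hj := (((analyticAt_const (v := sgn δ)).mul (hp j)).add
    (analyticAt_const (v := c.omega ν / 2))).add (analyticAt_const (v := I * β / 2))
  refine AnalyticAt.div (hcomp (hj.sub analyticAt_const)) (hcomp hj) ?_
  rw [show sgn δ * x j + c.omega ν / 2 + I * β / 2 = -(sgn (-δ) * x j - I * β / 2 - c.omega ν / 2) by
    simp [sgn]; ring, (SCase.isSigmaLike hc).odd]
  refine neg_ne_zero.2 (sub_half_omega_ne_zero hc ?_ (Nat.lt_succ_iff.1 (Finset.mem_range.1 hν)))
  convert s_sgn_mul_ne_zero hc (-δ) (h2 j δ) using 2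
  rcases Int.units_eq_one_or δ with rfl | rfl <;> simp [sgn] <;> ring

/-- The eigenvalue identity. -/
theorem sum_V_add_V0
    (hlam : ∀ ν ≤ c.rho, ∀ μ ≤ c.rho, c.s ((c.omega ν - c.omega μ + I * (lam - 1) * β) / 2) ≠ 0)
    (hbal : ∀ r a : ℝ, c = .elliptic r a → 2 * lam * ((N : ℝ) - 1) + ∑ ν, g ν - 2 = 0)
    (x : Fin N → ℂ) (h1 : ∀ j, c.s (2 * x j) ≠ 0)
    (h2 : ∀ j, ∀ ε : ℤˣ, c.s (2 * x j + sgn ε * I * β) ≠ 0)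
    (h3 : ∀ j k, j ≠ k → ∀ ε : ℤˣ, c.s (x j + sgn ε * x k) ≠ 0) :
    c.s (I * lam * β) * ∑ ε : ℤˣ, ∑ j, V c g lam β ε j x + V0 c g lam β x =
      eigenvalue c g lam β N := by
  have hs := SCase.isSigmaLike hc
  have hcont := hs.differentiable.continuous
  -- All coordinates move by the same h. For small h ≠ 0 the regularity conditions persist, being
  -- open, and the auxiliary condition holds, its zeros in h being isolated.
  let X : ℂ → Fin N → ℂ := fun h j => x j + h
  have hX : Continuous X := by fun_prop
  have hX0 : X 0 = x := by ext; simp [X]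
  have hF : ContinuousAt (fun y => c.s (I * lam * β) * ∑ ε : ℤˣ, ∑ j, V c g lam β ε j y +
      V0 c g lam β y) x := by
    refine ContinuousAt.add (ContinuousAt.mul continuousAt_const ?_)
      (analyticAt_V0 hc g lam β h2).continuousAt
    exact tendsto_finsetSum _ fun ε _ => tendsto_finsetSum _ fun j _ =>
      (analyticAt_V hc g lam β h1 h2 h3 ε j).continuousAt
  have key := eq_of_eventuallyEq_punctured (x := 0)
    (f := fun h => c.s (I * lam * β) * ∑ ε : ℤˣ, ∑ j, V c g lam β ε j (X h) + V0 c g lam β (X h))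
    (g := fun _ => eigenvalue c g lam β N)
    (ContinuousAt.comp (g := fun y => c.s (I * lam * β) * ∑ ε : ℤˣ, ∑ j, V c g lam β ε j y +
      V0 c g lam β y) (by rwa [hX0]) hX.continuousAt) continuousAt_const ?_
  · simpa only [hX0] using key
  have near : ∀ {f : ℂ → ℂ}, Continuous f → c.s (f 0) ≠ 0 → ∀ᶠ h in 𝓝[≠] (0 : ℂ), c.s (f h) ≠ 0 :=
    fun hf h0 => ((hcont.comp hf).continuousAt.eventually_ne h0).filter_mono nhdsWithin_le_nhds
  have e1 : ∀ᶠ h in 𝓝[≠] (0 : ℂ), ∀ j, c.s (2 * X h j) ≠ 0 :=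
    eventually_all.2 fun j => near (f := fun h => 2 * X h j) (by fun_prop) (by rw [hX0]; exact h1 j)
  have e2 : ∀ᶠ h in 𝓝[≠] (0 : ℂ), ∀ j, ∀ ε : ℤˣ, c.s (2 * X h j + sgn ε * I * β) ≠ 0 :=
    eventually_all.2 fun j => eventually_all.2 fun ε =>
      near (f := fun h => 2 * X h j + sgn ε * I * β) (by fun_prop) (by rw [hX0]; exact h2 j ε)
  have e3 : ∀ᶠ h in 𝓝[≠] (0 : ℂ), ∀ j k, j ≠ k → ∀ ε : ℤˣ, c.s (X h j + sgn ε * X h k) ≠ 0 :=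
    eventually_all.2 fun j => eventually_all.2 fun k => eventually_imp_distrib_left.2 fun hjk =>
      eventually_all.2 fun ε =>
        near (f := fun h => X h j + sgn ε * X h k) (by fun_prop) (by rw [hX0]; exact h3 j k hjk ε)
  have e4 : ∀ᶠ h in 𝓝[≠] (0 : ℂ), ∀ j, ∀ ε : ℤˣ,
      c.s (2 * (sgn ε * X h j - I * lam * β / 2)) ≠ 0 := by
    refine eventually_all.2 fun j => eventually_all.2 fun ε => ?_
    obtain ⟨w, hw⟩ := hs.nontrivial
    refine eventually_ne_zero_of_differentiable
      (f := fun h => c.s (2 * (sgn ε * X h j - I * lam * β / 2)))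
      (hs.differentiable.comp (by simp only [X]; fun_prop))
      -- This h solves 2(ε(x_j + h) - iλβ/2) = w, where s(w) ≠ 0.
      ⟨sgn ε * (w / 2 + I * lam * β / 2) - x j, ?_⟩ 0
    convert hw using 2
    have : sgn ε * sgn ε = 1 := by
      rcases Int.units_eq_one_or ε with rfl | rfl <;> simp [sgn]
    simp only [X]
    linear_combination (w + I * lam * β) * this
  filter_upwards [e1, e2, e3, e4] with h h1 h2 h3 h4
  exact sum_V_add_V0_generic hc g lam β hlam hbal (X h) h1 h2 h3 h4

end Identity

/-! ### The functional equation of the Gamma functions -/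

/-- The form of the functional equation of the Gamma function that is also meaningful at the
zeros of `s`: there, either the equation holds or both `s` and the right hand value vanish. -/
def IsGammaLike (c : SCase) (α : ℝ) (G : ℂ → ℂ) : Prop :=
  ∃ κ : ℂ, κ ≠ 0 ∧ ∀ x : ℂ, G (x + I * α / 2) = κ * c.s x * G (x - I * α / 2) ∨
    (c.s x = 0 ∧ G (x - I * α / 2) = 0)

/-- Only the zeros of s need an argument. A function in meromorphic normal form is analytic wherever
its value is nonzero, so if neither value of G vanished the equation would extend by continuity and
force one to be zero. -/
theorem isGammaLike_of_isGammaFunction {c : SCase} (hc : c.Positive) {α : ℝ} {G : ℂ → ℂ}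
    (h : c.IsGammaFunction α G) : IsGammaLike c α G := by
  obtain ⟨hG, κ, hκ, hfe⟩ := h
  have hs := SCase.isSigmaLike hc
  refine ⟨κ, hκ, fun x => ?_⟩
  by_cases hx : c.s x = 0
  · by_cases hm : G (x - I * α / 2) = 0
    · exact .inr ⟨hx, hm⟩
    · left
      rw [hx, mul_zero, zero_mul]
      by_contra hp
      have cont : ∀ {z}, G z ≠ 0 → ContinuousAt G z := fun {z} hz => by
        have hnf := hG (Set.mem_univ z)
        have h0 := hnf.meromorphicOrderAt_eq_zero_iff.2 hz
        exact (hnf.meromorphicOrderAt_nonneg_iff_analyticAt.1 h0.ge).continuousAt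
      refine hp ?_
      have := eq_of_eventuallyEq_punctured (x := x) (f := fun y => G (y + I * α / 2))
        (g := fun y => κ * c.s y * G (y - I * α / 2))
        ((cont hp).comp (f := fun y => y + I * α / 2) (by fun_prop))
        ((continuousAt_const.mul hs.differentiable.continuous.continuousAt).mul
          ((cont hm).comp (f := fun y => y - I * α / 2) (by fun_prop)))
        (by filter_upwards [hs.eventually_ne x] with y hy using hfe y hy)
      simpa [hx] using this
  · exact .inl (hfe x hx)

theorem isGammaLike_rational {α : ℝ} (hα : 0 < α) :
    IsGammaLike .rational α (SCase.rational.G α) := by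
  have hα' : (α : ℂ) ≠ 0 := ofReal_ne_zero.2 hα.ne'
  have hI := I_ne_zero
  refine ⟨1 / (I * α), by simp [hα'], fun x => ?_⟩
  simp only [SCase.G, SCase.s]
  rw [show 1 / 2 + (x + I * α / 2) / (I * α) = x / (I * α) + 1 by field_simp; ring,
    show 1 / 2 + (x - I * α / 2) / (I * α) = x / (I * α) by field_simp; ring]
  by_cases hx : x = 0
  -- The lower value is Γ(0), a pole, where the assigned value is 0.
  · right
    simp [hx]
  · left
    rw [Gamma_add_one _ (div_ne_zero hx (mul_ne_zero hI hα'))]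
    ring

/-- Both points have the same representative in the basic strip, and the strip index differs by one.
So one cosh factor enters the numerator or leaves the denominator, and the integral itself never has
to be analysed. -/
theorem hypG_add {a α : ℝ} (hα : 0 < α) (x : ℂ) :
    hypG a α (x + I * α / 2) = 2 * cosh (Real.pi * x / a) * hypG a α (x - I * α / 2) ∨
      (2 * cosh (Real.pi * x / a) = 0 ∧ hypG a α (x - I * α / 2) = 0) := by
  obtain ⟨n, hn⟩ : ∃ n : ℤ, n = round ((x - I * α / 2).im / α) := ⟨_, rfl⟩
  have hn' : round ((x + I * α / 2).im / α) = n + 1 := by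
    have e : (x + I * α / 2).im / α = (x - I * α / 2).im / α + 1 := by
      have : x + I * α / 2 = x - I * α / 2 + I * α := by ring
      rw [this, add_im, add_div]
      simp [hα.ne']
    rw [e, round_add_one, hn]
  have hx₀ : x + I * α / 2 - I * (n + 1 : ℤ) * α = x - I * α / 2 - I * n * α := by
    push_cast; ring
  simp only [hypG]
  rw [← hn, hn', hx₀]
  set y := x - I * α / 2 - I * n * α with hy
  rcases le_or_gt 0 n with h0 | h0
  · left
    obtain ⟨m, rfl⟩ := Int.eq_ofNat_of_zero_le h0
    have e1 : ((m : ℤ) + 1).toNat = m + 1 := by omega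
    have e2 : (-((m : ℤ) + 1)).toNat = 0 := by omega
    have e3 : (-(m : ℤ)).toNat = 0 := by omega
    rw [e1, e2, e3, Int.toNat_natCast, Finset.prod_range_succ,
      show Real.pi * (y + I * α * (m + 1 / 2)) / a = Real.pi * x / a by rw [hy]; push_cast; ring]
    ring
  · obtain ⟨m, hm⟩ := Int.eq_ofNat_of_zero_le (show 0 ≤ -(n + 1) by omega)
    have e1 : (n + 1).toNat = 0 := by omega
    have e2 : n.toNat = 0 := by omega
    have e3 : (-n).toNat = m + 1 := by omega
    have e4 : (-(n + 1)).toNat = m := by omega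
    have e5 : (n : ℂ) = -(m + 1) := by
      have : n = -((m : ℤ) + 1) := by omega
      rw [this]; push_cast; ring
    rw [e1, e2, e3, e4, Finset.prod_range_succ,
      show Real.pi * (y - I * α * (m + 1 / 2)) / a = Real.pi * x / a by rw [hy, e5]; ring]
    -- If the departing denominator factor vanishes, the lower point has value 0 by division by
    -- zero: the second alternative.
    by_cases hz : 2 * cosh (Real.pi * x / a) = 0
    · right
      simp [hz]
    · left
      have hz' := right_ne_zero_of_mul hz
      generalize ∏ k ∈ Finset.range m, 2 * cosh (Real.pi * (y - I * α * (k + 1 / 2)) / a) = Q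
      generalize cosh (Real.pi * x / a) = C at *
      field_simp

theorem isGammaLike_hyperbolic {a α : ℝ} (ha : 0 < a) (hα : 0 < α) :
    IsGammaLike (.hyperbolic a) α ((SCase.hyperbolic a).G α) := by
  have ha' : (a : ℂ) ≠ 0 := ofReal_ne_zero.2 ha.ne'
  have hπ : (Real.pi : ℂ) ≠ 0 := ofReal_ne_zero.2 Real.pi_ne_zero
  have hI := I_ne_zero
  refine ⟨-2 * I * Real.pi / a, by simp [ha', hπ], fun x => ?_⟩
  have e : 2 * cosh (Real.pi * (x - I * a / 2) / a) =
      -2 * I * Real.pi / a * (SCase.hyperbolic a).s x := by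
    simp only [SCase.s]
    rw [show Real.pi * (x - I * a / 2) / a = Real.pi * x / a - Real.pi / 2 * I by field_simp,
      cosh_sub, cosh_mul_I, sinh_mul_I, sin_pi_div_two, cos_pi_div_two]
    field_simp
    ring
  have h := hypG_add (a := a) hα (x - I * a / 2)
  rw [e] at h
  simp only [SCase.G]
  rw [show x + I * α / 2 - I * a / 2 = x - I * a / 2 + I * α / 2 by ring,
    show x - I * α / 2 - I * a / 2 = x - I * a / 2 - I * α / 2 by ring]
  refine h.imp id fun h => ⟨?_, h.2⟩
  exact (mul_eq_zero.1 h.1).resolve_left (by simp [ha', hπ])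

theorem summable_norm_inv_sub_one {ι : Type*} {F : ι → ℂ} (h : Summable fun i => ‖F i - 1‖) :
    Summable fun i => ‖(F i)⁻¹ - 1‖ := by
  refine Summable.of_norm_bounded_eventually (h.mul_left 2) ?_
  have h0 := h.tendsto_cofinite_zero
  filter_upwards [h0.eventually_le_const (show (0 : ℝ) < 1 / 2 by norm_num)] with i hi
  have h1 : 1 / 2 ≤ ‖F i‖ := by
    have := norm_sub_norm_le (1 : ℂ) (1 - F i)
    rw [norm_sub_rev 1, norm_one, sub_sub_cancel] at this
    linarith
  have hF : F i ≠ 0 := fun h => by rw [h, norm_zero] at h1; norm_num at h1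
  rw [norm_norm, show (F i)⁻¹ - 1 = -(F i - 1) / F i by field_simp; ring, norm_div, norm_neg,
    div_le_iff₀ (norm_pos_iff.2 hF)]
  nlinarith [norm_nonneg (F i - 1)]

theorem multipliable_of_summable_norm_sub_one {ι : Type*} {F : ι → ℂ}
    (h : Summable fun i => ‖F i - 1‖) : Multipliable F := by
  simpa using multipliable_one_add_of_summable h

/-- Absolute convergence permits splitting off the factors with second index 0, the ones that a
shift by iα adds or removes. -/
theorem tprod_prod_eq_zero_mul {F : ℕ × ℕ → ℂ} (h : Summable fun i => ‖F i - 1‖) :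
    ∏' i, F i = (∏' n, F (n, 0)) * ∏' i : ℕ × ℕ, F (i.1, i.2 + 1) := by
  let u : ℕ → ℕ × ℕ := fun n => (n, 0)
  let v : ℕ × ℕ → ℕ × ℕ := fun i => (i.1, i.2 + 1)
  have hu : Function.Injective u := fun m n h => (Prod.mk.inj h).1
  have hv : Function.Injective v := fun m n h => by
    simp only [v, Prod.mk.injEq] at h
    ext <;> omega
  have huv : IsCompl (Set.range u) (Set.range v) := by
    refine ⟨Set.disjoint_left.2 ?_, codisjoint_iff.2 (Set.eq_univ_of_forall ?_)⟩
    · rintro _ ⟨n, rfl⟩ ⟨i, hi⟩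
      simp [u, v] at hi
    · rintro ⟨n, _ | m⟩
      · exact .inl ⟨n, rfl⟩
      · exact .inr ⟨(n, m), rfl⟩
  have h1 := (multipliable_of_summable_norm_sub_one (h.comp_injective hu)).hasProd
  have h2 := (multipliable_of_summable_norm_sub_one (h.comp_injective hv)).hasProd
  exact (HasProd.mul_isCompl huv (hu.hasProd_range_iff.2 h1) (hv.hasProd_range_iff.2 h2)).tprod_eq

/-- The two shifted products differ by the factor 1 - w with w = exp(2irx). The Gaussian contributes
exp(-irx), and exp(-irx)(1 - w) = -2i sin(rx). -/
theorem isGammaLike_trigonometric {r α : ℝ} (hr : 0 < r) (hα : 0 < α) :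
    IsGammaLike (.trigonometric r) α ((SCase.trigonometric r).G α) := by
  have hr' : (r : ℂ) ≠ 0 := ofReal_ne_zero.2 hr.ne'
  have hα' : (α : ℂ) ≠ 0 := ofReal_ne_zero.2 hα.ne'
  have hI := I_ne_zero
  refine ⟨-2 * I * r, by simp [hr'], fun x => ?_⟩
  set q := exp (-(r * α) : ℂ) ^ 2 with hqd
  have hq2 : q = exp (-(2 * r * α)) := by rw [hqd, sq, ← exp_add]; ring_nf
  have hq : ‖q‖ < 1 := by rw [hq2]; exact norm_exp_neg_two_lt_one hr hα
  set w := exp (2 * I * r * x) with hw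
  have hfac : ∀ (n : ℕ), exp (-(r * α * (2 * (n + 1) - 1))) = q ^ n * exp (-(r * α)) := by
    intro n
    rw [hqd, ← pow_mul, ← pow_succ, ← exp_nat_mul]
    push_cast
    ring_nf
  have hp : trigG r α (x + I * α / 2) = ∏' n : ℕ, (1 - q ^ (n + 1) * w)⁻¹ := by
    refine tprod_congr fun n => ?_
    rw [hfac, show 2 * I * r * (x + I * α / 2) = 2 * I * r * x + -(r * α) by
      ring_nf; rw [I_sq]; ring, exp_add, hqd]
    ring
  have hm : trigG r α (x - I * α / 2) = ∏' n : ℕ, (1 - q ^ n * w)⁻¹ := by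
    refine tprod_congr fun n => ?_
    have : exp (-(r * α) : ℂ) * exp (r * α) = 1 := by rw [← exp_add, neg_add_cancel, exp_zero]
    rw [hfac, show 2 * I * r * (x - I * α / 2) = 2 * I * r * x + r * α by
      ring_nf; rw [I_sq]; ring, exp_add]
    congr 2
    linear_combination (q ^ n * w) * this
  have hstep : trigG r α (x - I * α / 2) = (1 - w)⁻¹ * trigG r α (x + I * α / 2) := by
    rw [hp, hm]
    have hs : Summable fun n : ℕ => ‖(1 - q ^ (n + 1) * w)⁻¹ - 1‖ :=
      summable_norm_inv_sub_one (by simpa using summable_norm_pow_succ_mul hq w)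
    rw [tprod_eq_zero_mul' (f := fun n : ℕ => (1 - q ^ n * w)⁻¹)
      (multipliable_of_summable_norm_sub_one hs)]
    simp
  have hsin : exp (-(I * r * x)) * (1 - w) = -2 * I * r * (SCase.trigonometric r).s x := by
    simp only [SCase.s, sin]
    rw [mul_sub, mul_one, hw, ← exp_add, show -(I * r * x) + 2 * I * r * x = r * x * I by ring,
      show -(I * r * x) = -(r * x) * I by ring]
    field_simp
    rw [I_sq]
    ring
  simp only [SCase.G]
  -- Then the lower product contains the inverse of 0, so its value is 0.
  by_cases h1 : w = 1
  · right
    rw [hstep, h1, sub_self, inv_zero, zero_mul, mul_zero]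
    rw [h1, sub_self, mul_zero] at hsin
    exact ⟨(mul_eq_zero.1 hsin.symm).resolve_left (by simp [hr']), rfl⟩
  · left
    have h1' : 1 - w ≠ 0 := sub_ne_zero.2 (Ne.symm h1)
    have hexp : exp (-(r * (x + I * α / 2) ^ 2 / (2 * α))) =
        exp (-(r * (x - I * α / 2) ^ 2 / (2 * α))) * exp (-(I * r * x)) := by
      rw [← exp_add]
      congr 1
      field_simp
      ring
    rw [← hsin, hstep, hexp]
    field_simp

/-- A shift by iα moves the second index by one in numerators and denominators. The surplus factors
are ∏(1 - pⁿw) over n ≥ 0 and ∏(1 - pⁿ/w) over n ≥ 1; with exp(-irx) from the Gaussian they form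
s(x) up to a constant involving ∏(1 - pⁿ). -/
theorem isGammaLike_elliptic {r a α : ℝ} (hr : 0 < r) (ha : 0 < a) (hα : 0 < α) :
    IsGammaLike (.elliptic r a) α ((SCase.elliptic r a).G α) := by
  have hr' : (r : ℂ) ≠ 0 := ofReal_ne_zero.2 hr.ne'
  have hα' : (α : ℂ) ≠ 0 := ofReal_ne_zero.2 hα.ne'
  have hI := I_ne_zero
  have hP1 := eulerProd_one_ne_zero hr ha
  set p := exp (-(r * a) : ℂ) ^ 2 with hpd
  set q := exp (-(r * α) : ℂ) ^ 2 with hqd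
  have hp2 : exp (-(2 * r * a) : ℂ) = p := by rw [hpd, sq, ← exp_add]; ring_nf
  have hq2 : exp (-(2 * r * α) : ℂ) = q := by rw [hqd, sq, ← exp_add]; ring_nf
  have hp : ‖p‖ < 1 := by rw [← hp2]; exact norm_exp_neg_two_lt_one hr ha
  have hq : ‖q‖ < 1 := by rw [← hq2]; exact norm_exp_neg_two_lt_one hr hα
  rw [hp2] at hP1
  refine ⟨-I * r / eulerProd p 1, by simp [hr', hP1], fun x => ?_⟩
  set w := exp (2 * I * r * x) with hw
  set W := exp (-(2 * I * r * x)) with hW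
  let A : ℕ × ℕ → ℂ := fun i => 1 - p ^ (i.1 + 1) * q ^ i.2 * W
  let B : ℕ × ℕ → ℂ := fun i => 1 - p ^ i.1 * q ^ i.2 * w
  have hpq : Summable fun i : ℕ × ℕ => ‖p‖ ^ i.1 * ‖q‖ ^ i.2 :=
    (summable_geometric_of_lt_one (norm_nonneg _) hp).mul_of_nonneg
      (summable_geometric_of_lt_one (norm_nonneg _) hq) (fun _ => by positivity)
      (fun _ => by positivity)
  have hA : Summable fun i => ‖A i - 1‖ := by
    refine (hpq.mul_right (‖p‖ * ‖W‖)).congr fun i => ?_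
    simp only [A, sub_sub_cancel_left, norm_neg, norm_mul, norm_pow]
    ring
  have hB : Summable fun i => ‖B i - 1‖ := by
    refine (hpq.mul_right ‖w‖).congr fun i => ?_
    simp only [B, sub_sub_cancel_left, norm_neg, norm_mul, norm_pow]
  have hB' := summable_norm_inv_sub_one hB
  let v : ℕ × ℕ → ℕ × ℕ := fun i => (i.1, i.2 + 1)
  have hv : Function.Injective v := fun m n h => by
    simp only [v, Prod.mk.injEq] at h
    ext <;> omega
  have mA := multipliable_of_summable_norm_sub_one hA
  have mB := multipliable_of_summable_norm_sub_one hB'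
  have mAv := multipliable_of_summable_norm_sub_one (hA.comp_injective hv)
  have mBv := multipliable_of_summable_norm_sub_one (hB'.comp_injective hv)
  have hfac : ∀ (b : ℝ) (n : ℕ), exp (-(r * b * (2 * (n + 1) - 1))) =
      (exp (-(r * b) : ℂ) ^ 2) ^ n * exp (-(r * b)) := by
    intro b n
    rw [← pow_mul, ← pow_succ, ← exp_nat_mul]
    push_cast
    ring_nf
  have hEa : exp (-(r * a) : ℂ) * exp (r * a) = 1 := by rw [← exp_add, neg_add_cancel, exp_zero]
  have hEα : exp (-(r * α) : ℂ) * exp (r * α) = 1 := by rw [← exp_add, neg_add_cancel, exp_zero]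
  have hGp : ellG r a α (x + I * α / 2 - I * a / 2) = (∏' i, A i) * ∏' i, (B (v i))⁻¹ := by
    rw [← mA.tprod_mul mBv]
    refine tprod_congr fun i => ?_
    rw [hfac, hfac, show 2 * I * r * (x + I * α / 2 - I * a / 2) =
      2 * I * r * x + -(r * α) + r * a by ring_nf; rw [I_sq]; ring, neg_add, neg_add, neg_neg,
      exp_add, exp_add, exp_add, exp_add, ← hpd, ← hqd, div_eq_mul_inv]
    congr 2
    · linear_combination (p ^ i.1 * q ^ i.2 * exp (-(r * a)) ^ 2 * W) * hEα
    · linear_combination (-p ^ i.1 * q ^ i.2 * exp (-(r * α)) ^ 2 * w) * hEa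
  have hGm : ellG r a α (x - I * α / 2 - I * a / 2) = (∏' i, A (v i)) * ∏' i, (B i)⁻¹ := by
    rw [← mAv.tprod_mul mB]
    refine tprod_congr fun i => ?_
    rw [hfac, hfac, show 2 * I * r * (x - I * α / 2 - I * a / 2) =
      2 * I * r * x + r * α + r * a by ring_nf; rw [I_sq]; ring, neg_add, neg_add,
      exp_add, exp_add, exp_add, exp_add, ← hpd, ← hqd, div_eq_mul_inv]
    congr 2
    · simp only [v, pow_succ, hpd, hqd]
      ring
    · linear_combination (-p ^ i.1 * q ^ i.2 * w) * (hEa * exp (-(r * α)) * exp (r * α) + hEα)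
  have sA : ∏' i, A i = eulerProd p W * ∏' i, A (v i) := by
    rw [tprod_prod_eq_zero_mul hA]
    simp [A, v, eulerProd]
  have sB : ∏' i, (B i)⁻¹ = (∏' n : ℕ, (1 - p ^ n * w)⁻¹) * ∏' i, (B (v i))⁻¹ := by
    rw [tprod_prod_eq_zero_mul hB']
    simp [B, v]
  have sB0 : ∏' n : ℕ, (1 - p ^ n * w) = (1 - w) * eulerProd p w := by
    rw [tprod_eq_zero_mul' (f := fun n : ℕ => 1 - p ^ n * w) (multipliable_eulerProd hp w)]
    simp [eulerProd]
  have hsin : exp (-(I * r * x)) * ((1 - w) * eulerProd p w * eulerProd p W) =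
      -I * r / eulerProd p 1 * (SCase.elliptic r a).s x := by
    have : exp (-(I * r * x)) * (1 - w) = -2 * I * sin (r * x) := by
      rw [sin, mul_sub, mul_one, hw, ← exp_add,
        show -(I * r * x) + 2 * I * r * x = r * x * I by ring,
        show -(I * r * x) = -(r * x) * I by ring]
      field_simp
      rw [I_sq]
      ring
    rw [elliptic_s_eq hr ha, hp2, ← hw, ← hW]
    field_simp
    linear_combination eulerProd p w * eulerProd p W * this
  simp only [SCase.G]
  -- A vanishing denominator factor makes the lower value 0 and s(x) = 0.
  by_cases hz : ∃ n : ℕ, 1 - p ^ n * w = 0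
  · right
    have z1 : ∏' n : ℕ, (1 - p ^ n * w) = 0 := tprod_of_exists_eq_zero hz
    have z2 : ∏' i, (B i)⁻¹ = 0 := by
      obtain ⟨n, hn⟩ := hz
      exact tprod_of_exists_eq_zero ⟨(n, 0), by simp [B, hn]⟩
    rw [hGm, z2, mul_zero, mul_zero]
    rw [← sB0, z1, zero_mul, mul_zero] at hsin
    exact ⟨(mul_eq_zero.1 hsin.symm).resolve_left (by simp [hr', hP1]), rfl⟩
  · left
    push Not at hz
    have hu : Function.Injective fun n : ℕ => (n, 0) := fun m n h => (Prod.mk.inj h).1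
    have e : (∏' n : ℕ, (1 - p ^ n * w)) * ∏' n : ℕ, (1 - p ^ n * w)⁻¹ = 1 := by
      have m1 := multipliable_of_summable_norm_sub_one (hB.comp_injective hu)
      have m2 := multipliable_of_summable_norm_sub_one (hB'.comp_injective hu)
      simp only [B, pow_zero, mul_one] at m1 m2
      rw [← m1.tprod_mul m2]
      simp [mul_inv_cancel₀ (hz _)]
    have hexp : exp (-(r * (x + I * α / 2) ^ 2 / (2 * α))) =
        exp (-(r * (x - I * α / 2) ^ 2 / (2 * α))) * exp (-(I * r * x)) := by
      rw [← exp_add]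
      congr 1
      field_simp
      ring
    rw [sB0] at e
    rw [← hsin, hGp, hGm, hexp, sA, sB]
    linear_combination (-exp (-(r * (x - I * α / 2) ^ 2 / (2 * α))) * exp (-(I * r * x)) *
      eulerProd p W * (∏' i, A (v i)) * ∏' i, (B (v i))⁻¹) * e

theorem isGammaLike {c : SCase} (hc : c.Positive) {α : ℝ} (hα : 0 < α) {G : ℂ → ℂ}
    (hG : G = c.G α ∨ c.IsGammaFunction α G) : IsGammaLike c α G := by
  rcases hG with rfl | hG
  · match c, hc with
    | .rational, _ => exact isGammaLike_rational hα
    | .trigonometric r, hr => exact isGammaLike_trigonometric hr hα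
    | .hyperbolic a, ha => exact isGammaLike_hyperbolic ha hα
    | .elliptic r a, h => exact isGammaLike_elliptic h.1 h.2 hα
  · exact isGammaLike_of_isGammaFunction hc hG

/-! ### Detailed balance for the squared ground state -/

section GroundState

variable {c : SCase} (hc : c.Positive) {N : ℕ} (g : Fin (2 * c.rho + 2) → ℝ) (lam β : ℝ)
  {G : ℂ → ℂ}

/-- The factor of the ground state squared that belongs to one particle. -/
noncomputable def oneParticle (G : ℂ → ℂ) (X : ℂ) : ℂ :=
  G (2 * X + I * β / 2) * G (-(2 * X) + I * β / 2) /
    ∏ ν, (G (X + I * β / 2 - I * g ν * β) * G (-X + I * β / 2 - I * g ν * β))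

/-- The factor of the ground state squared that belongs to a pair of particles. -/
noncomputable def twoParticle (G : ℂ → ℂ) (X Y : ℂ) : ℂ :=
  ∏ ε : ℤˣ, ∏ ε' : ℤˣ, G (sgn ε * X + sgn ε' * Y + I * β / 2) /
    G (sgn ε * X + sgn ε' * Y - I * lam * β + I * β / 2)

theorem twoParticle_comm (X Y : ℂ) : twoParticle lam β G X Y = twoParticle lam β G Y X := by
  rw [twoParticle, twoParticle, Finset.prod_comm]
  exact Finset.prod_congr rfl fun ε _ => Finset.prod_congr rfl fun ε' _ => by
    rw [add_comm (sgn ε' * X)]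

/-- The four sign choices are grouped as ±(X + δY), so that a shift of X becomes a shift of the
single variable z = X + δY. -/
theorem twoParticle_eq (X Y : ℂ) : twoParticle lam β G X Y =
    ∏ δ : ℤˣ, (G (X + sgn δ * Y + I * β / 2) / G (X + sgn δ * Y - I * lam * β + I * β / 2)) *
      (G (-(X + sgn δ * Y) + I * β / 2) / G (-(X + sgn δ * Y) - I * lam * β + I * β / 2)) := by
  rw [Finset.prod_mul_distrib, twoParticle, prod_units _ (1 : ℤˣ)]
  congr 1
  · simp [sgn]
  · rw [← Equiv.prod_comp (Equiv.neg ℤˣ)]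
    refine Finset.prod_congr rfl fun δ _ => ?_
    have : sgn (-1) * X + sgn ((Equiv.neg ℤˣ) δ) * Y = -(X + sgn δ * Y) := by
      simp [sgn]
      ring
    rw [this]

/-- This separates the pairs containing j, the only ones affected by a shift of x_j. -/
theorem prod_pairs_eq {M : Type*} [CommMonoid M] (u : Fin N → Fin N → M)
    (hu : ∀ a b, u a b = u b a) (j : Fin N) :
    ∏ a, ∏ b ∈ Finset.Ioi a, u a b = (∏ k ∈ Finset.univ.erase j, u j k) *
      ∏ a ∈ Finset.univ.erase j, ∏ b ∈ (Finset.Ioi a).erase j, u a b := by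
  rw [← Finset.mul_prod_erase _ _ (Finset.mem_univ j)]
  have h1 : ∀ a ∈ Finset.univ.erase j, ∏ b ∈ Finset.Ioi a, u a b =
      (if a < j then u j a else 1) * ∏ b ∈ (Finset.Ioi a).erase j, u a b := by
    intro a _
    split_ifs with h
    · rw [← Finset.mul_prod_erase _ _ (Finset.mem_Ioi.2 h), hu]
    · rw [Finset.erase_eq_of_notMem (by simpa using h), one_mul]
  have h2 : ∏ b ∈ Finset.Ioi j, u j b =
      ∏ k ∈ Finset.univ.erase j, if k < j then 1 else u j k := by
    have h3 : ∏ b ∈ Finset.Ioi j, u j b = ∏ k ∈ Finset.Ioi j, if k < j then 1 else u j k :=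
      Finset.prod_congr rfl fun k hk => by rw [if_neg (not_lt.2 (Finset.mem_Ioi.1 hk).le)]
    rw [h3]
    refine Finset.prod_subset (fun k hk => ?_) fun k hk hk' => ?_
    · simpa using (Finset.mem_Ioi.1 hk).ne'
    · exact if_pos (lt_of_le_of_ne (not_lt.1 (by simpa using hk')) (Finset.ne_of_mem_erase hk))
  rw [Finset.prod_congr rfl h1, Finset.prod_mul_distrib, ← mul_assoc, h2, ← Finset.prod_mul_distrib]
  congr 1
  exact Finset.prod_congr rfl fun k _ => by split_ifs <;> simp

theorem groundStateSq_eq (x : Fin N → ℂ) (j : Fin N) : groundStateSq c g lam β G x =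
    oneParticle g β G (x j) * (∏ k ∈ Finset.univ.erase j, twoParticle lam β G (x j) (x k)) *
    ((∏ k ∈ Finset.univ.erase j, oneParticle g β G (x k)) *
      ∏ a ∈ Finset.univ.erase j, ∏ b ∈ (Finset.Ioi a).erase j,
        twoParticle lam β G (x a) (x b)) := by
  have h1 : groundStateSq c g lam β G x = (∏ k, oneParticle g β G (x k)) *
      ∏ a, ∏ b ∈ Finset.Ioi a, twoParticle lam β G (x a) (x b) := rfl
  rw [h1, prod_pairs_eq (fun a b => twoParticle lam β G (x a) (x b))
    (fun a b => twoParticle_comm lam β _ _) j, ← Finset.mul_prod_erase _ _ (Finset.mem_univ j)]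
  ring

theorem groundStateSq_ne_zero {x : Fin N → ℂ} (hx : IsRegular c g lam β G x) :
    groundStateSq c g lam β G x ≠ 0 := by
  obtain ⟨-, -, -, h4, h5, h6⟩ := hx
  refine mul_ne_zero (Finset.prod_ne_zero_iff.2 fun j _ => div_ne_zero (mul_ne_zero ?_ ?_)
    (Finset.prod_ne_zero_iff.2 fun ν _ => mul_ne_zero ?_ ?_))
    (Finset.prod_ne_zero_iff.2 fun j _ => Finset.prod_ne_zero_iff.2 fun k hk =>
      Finset.prod_ne_zero_iff.2 fun ε _ => Finset.prod_ne_zero_iff.2 fun ε' _ => ?_)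
  · simpa [sgn] using h4 j 1
  · simpa [sgn] using h4 j (-1)
  · simpa [sgn] using h5 j ν 1
  · simpa [sgn] using h5 j ν (-1)
  · have := h6 j k (Finset.mem_Ioi.1 hk).ne ε ε'
    exact div_ne_zero this.1 this.2

/-- The first form serves the denominators of V, where s ≠ 0 is part of regularity. The second
serves its numerators: there s ≠ 0 is deduced from both Gamma values being nonzero. -/
theorem IsGammaLike.exists_eq (hG : IsGammaLike c β G) : ∃ κ : ℂ, κ ≠ 0 ∧
    (∀ z w, c.s z ≠ 0 → w = z - I * β → G (z + I * β / 2) = κ * c.s z * G (w + I * β / 2)) ∧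
    (∀ z w, w = z - I * β → G (z + I * β / 2) ≠ 0 → G (w + I * β / 2) ≠ 0 →
      c.s z ≠ 0 ∧ G (z + I * β / 2) = κ * c.s z * G (w + I * β / 2)) := by
  obtain ⟨κ, hκ, h⟩ := hG
  have e : ∀ z w, w = z - I * β → w + I * β / 2 = z - I * β / 2 := fun z w hw => by
    rw [hw]; ring
  refine ⟨κ, hκ, fun z w hz hw => ?_, fun z w hw h1 h2 => ?_⟩
  · rw [e z w hw]
    exact (h z).resolve_right fun h' => hz h'.1
  · rw [e z w hw] at h2 ⊢
    have h3 := (h z).resolve_right fun h' => h2 h'.2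
    refine ⟨fun h0 => h1 ?_, h3⟩
    rw [h3, h0, mul_zero, zero_mul]

include hc

/-- Here 2X = 2Y + 2iβ, so the functional equation is used twice for each of G(±2X + iβ/2), and once
for each g_ν factor. The constants κ cancel between the arguments of opposite sign. -/
theorem oneParticle_shift (hG : IsGammaLike c β G) {X Y : ℂ} (hXY : X = Y + I * β)
    (hs1 : c.s (2 * X) ≠ 0) (hs2 : c.s (2 * X - I * β) ≠ 0)
    (hs3 : c.s (2 * Y) ≠ 0) (hs4 : c.s (2 * Y + I * β) ≠ 0)
    (hX1 : ∀ ν, G (X + I * β / 2 - I * g ν * β) ≠ 0)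
    (hX2 : ∀ ν, G (-X + I * β / 2 - I * g ν * β) ≠ 0)
    (hY1 : ∀ ν, G (Y + I * β / 2 - I * g ν * β) ≠ 0)
    (hY2 : ∀ ν, G (-Y + I * β / 2 - I * g ν * β) ≠ 0) :
    (∏ ν, c.s (X - I * g ν * β) ≠ 0) ∧
    (∏ ν, c.s (-Y - I * g ν * β)) / (c.s (-(2 * Y)) * c.s (-(2 * Y) - I * β)) *
        oneParticle g β G Y =
      (∏ ν, c.s (X - I * g ν * β)) / (c.s (2 * X) * c.s (2 * X - I * β)) *
        oneParticle g β G X := by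
  have hodd := (SCase.isSigmaLike hc).odd
  obtain ⟨κ, hκ, hG1, hG2⟩ := hG.exists_eq
  have hs3' : c.s (-(2 * Y)) ≠ 0 := by rw [hodd]; exact neg_ne_zero.2 hs3
  have hs4' : c.s (-(2 * Y) - I * β) ≠ 0 := by
    rw [show -(2 * Y) - I * β = -(2 * Y + I * β) by ring, hodd]; exact neg_ne_zero.2 hs4
  have e1 := hG1 (2 * X) (2 * X - I * β) hs1 rfl
  have e2 := hG1 (2 * X - I * β) (2 * Y) hs2 (by rw [hXY]; ring)
  have e3 := hG1 (-(2 * Y)) (-(2 * Y) - I * β) hs3' rfl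
  have e4 := hG1 (-(2 * Y) - I * β) (-(2 * X)) hs4' (by rw [hXY]; ring)
  have f1 : ∀ ν, c.s (X - I * g ν * β) ≠ 0 ∧ G (X + I * β / 2 - I * g ν * β) =
      κ * c.s (X - I * g ν * β) * G (Y + I * β / 2 - I * g ν * β) := by
    intro ν
    have := hG2 (X - I * g ν * β) (Y - I * g ν * β) (by rw [hXY]; ring)
    simp only [sub_add_eq_add_sub] at this
    exact this (hX1 ν) (hY1 ν)
  have f2 : ∀ ν, c.s (-Y - I * g ν * β) ≠ 0 ∧ G (-Y + I * β / 2 - I * g ν * β) =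
      κ * c.s (-Y - I * g ν * β) * G (-X + I * β / 2 - I * g ν * β) := by
    intro ν
    have := hG2 (-Y - I * g ν * β) (-X - I * g ν * β) (by rw [hXY]; ring)
    simp only [sub_add_eq_add_sub] at this
    exact this (hY2 ν) (hX2 ν)
  refine ⟨Finset.prod_ne_zero_iff.2 fun ν _ => (f1 ν).1, ?_⟩
  have p1 : (∏ ν, c.s (-Y - I * g ν * β)) /
      ∏ ν, (G (Y + I * β / 2 - I * g ν * β) * G (-Y + I * β / 2 - I * g ν * β)) =
      (∏ ν, c.s (X - I * g ν * β)) /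
      ∏ ν, (G (X + I * β / 2 - I * g ν * β) * G (-X + I * β / 2 - I * g ν * β)) := by
    rw [← Finset.prod_div_distrib, ← Finset.prod_div_distrib]
    refine Finset.prod_congr rfl fun ν _ => ?_
    have h1 := (f1 ν).1
    have h2 := (f2 ν).1
    have h3 := hX2 ν
    have h4 := hY1 ν
    rw [(f1 ν).2, (f2 ν).2]
    generalize G (Y + I * β / 2 - I * g ν * β) = a at *
    generalize G (-X + I * β / 2 - I * g ν * β) = b at *
    generalize c.s (X - I * g ν * β) = d at *
    generalize c.s (-Y - I * g ν * β) = e at *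
    field_simp
  rw [oneParticle, oneParticle, e1, e2, e3, e4]
  generalize c.s (2 * X) = a1 at *
  generalize c.s (2 * X - I * β) = a2 at *
  generalize c.s (-(2 * Y)) = a3 at *
  generalize c.s (-(2 * Y) - I * β) = a4 at *
  generalize G (2 * Y + I * β / 2) = b1 at *
  generalize G (-(2 * X) + I * β / 2) = b2 at *
  calc _ = κ ^ 2 * b1 * b2 * ((∏ ν, c.s (-Y - I * g ν * β)) /
      ∏ ν, (G (Y + I * β / 2 - I * g ν * β) * G (-Y + I * β / 2 - I * g ν * β))) := by
        generalize ∏ ν, c.s (-Y - I * g ν * β) = P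
        generalize ∏ ν, (G (Y + I * β / 2 - I * g ν * β) * G (-Y + I * β / 2 - I * g ν * β)) = Q
        field_simp
    _ = _ := by
        rw [p1]
        generalize ∏ ν, c.s (X - I * g ν * β) = P
        generalize ∏ ν, (G (X + I * β / 2 - I * g ν * β) * G (-X + I * β / 2 - I * g ν * β)) = Q
        field_simp

/-- One application of the functional equation to each of the four Gamma factors; κ cancels within
each quotient. -/
theorem pair_shift (hG : IsGammaLike c β G) {z w : ℂ} (hzw : w = z - I * β)
    (hz : c.s z ≠ 0) (hw : c.s w ≠ 0)
    (hz1 : G (z - I * lam * β + I * β / 2) ≠ 0) (hz2 : G (-z - I * lam * β + I * β / 2) ≠ 0)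
    (hw1 : G (w - I * lam * β + I * β / 2) ≠ 0) (hw2 : G (-w - I * lam * β + I * β / 2) ≠ 0) :
    c.s (z - I * lam * β) ≠ 0 ∧
    c.s (w + I * lam * β) / c.s w *
      (G (w + I * β / 2) / G (w - I * lam * β + I * β / 2) *
        (G (-w + I * β / 2) / G (-w - I * lam * β + I * β / 2))) =
    c.s (z - I * lam * β) / c.s z *
      (G (z + I * β / 2) / G (z - I * lam * β + I * β / 2) *
        (G (-z + I * β / 2) / G (-z - I * lam * β + I * β / 2))) := by
  have hodd := (SCase.isSigmaLike hc).odd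
  obtain ⟨κ, hκ, hG1, hG2⟩ := hG.exists_eq
  have hw' : c.s (-w) ≠ 0 := by rw [hodd]; exact neg_ne_zero.2 hw
  have e1 := hG1 z w hz hzw
  have e2 := hG1 (-w) (-z) hw' (by rw [hzw]; ring)
  obtain ⟨h3, e3⟩ := hG2 (z - I * lam * β) (w - I * lam * β) (by rw [hzw]; ring) hz1 hw1
  obtain ⟨h4, e4⟩ := hG2 (-w - I * lam * β) (-z - I * lam * β) (by rw [hzw]; ring) hw2 hz2
  rw [show -w - I * lam * β = -(w + I * lam * β) by ring, hodd] at h4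
  refine ⟨h3, ?_⟩
  rw [e1, e2, e3, e4, hodd w, show -w - I * lam * β = -(w + I * lam * β) by ring, hodd]
  generalize c.s z = a1 at *
  generalize c.s w = a2 at *
  generalize c.s (z - I * lam * β) = a3 at *
  generalize c.s (w + I * lam * β) = a4 at *
  generalize G (w + I * β / 2) = b1 at *
  generalize G (-z + I * β / 2) = b2 at *
  generalize G (w - I * lam * β + I * β / 2) = b3 at *
  generalize G (-z - I * lam * β + I * β / 2) = b4 at *
  rw [neg_ne_zero] at h4
  field_simp

/-- The detailed balance: multiply the one-particle relation for x_j by the pair relations for all k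
≠ j and δ = ±; factors without x_j are unchanged. -/
theorem V_mul_groundStateSq (hG : IsGammaLike c β G) {x y : Fin N → ℂ} {j : Fin N}
    (hj : x j = y j + I * β) (hk : ∀ k, k ≠ j → x k = y k)
    (hx : IsRegular c g lam β G x) (hy : IsRegular c g lam β G y) :
    V c g lam β 1 j x ≠ 0 ∧
    V c g lam β (-1) j y * groundStateSq c g lam β G y =
      V c g lam β 1 j x * groundStateSq c g lam β G x := by
  obtain ⟨hx1, hx2, hx3, -, hx5, hx6⟩ := hx
  obtain ⟨hy1, hy2, hy3, -, hy5, hy6⟩ := hy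
  have one := oneParticle_shift hc g β hG hj (hx1 j)
    (by simpa [sgn, sub_eq_add_neg] using hx2 j (-1)) (hy1 j) (by simpa [sgn] using hy2 j 1)
    (fun ν => by simpa [sgn] using hx5 j ν 1) (fun ν => by simpa [sgn] using hx5 j ν (-1))
    (fun ν => by simpa [sgn] using hy5 j ν 1) (fun ν => by simpa [sgn] using hy5 j ν (-1))
  have two : ∀ k ∈ Finset.univ.erase j, ∀ δ : ℤˣ, _ := fun k hk' δ =>
    pair_shift hc lam β hG (z := x j + sgn δ * x k) (w := y j + sgn δ * y k)
      (by rw [hj, hk k (Finset.ne_of_mem_erase hk')]; ring)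
      (hx3 j k (Finset.ne_of_mem_erase hk').symm δ) (hy3 j k (Finset.ne_of_mem_erase hk').symm δ)
      (by simpa [sgn] using (hx6 j k (Finset.ne_of_mem_erase hk').symm 1 δ).2)
      (by
        have := (hx6 j k (Finset.ne_of_mem_erase hk').symm (-1) (-δ)).2
        simp only [sgn, Units.val_neg, Units.val_one, Int.cast_neg, Int.cast_one] at this
        convert this using 2
        ring)
      (by simpa [sgn] using (hy6 j k (Finset.ne_of_mem_erase hk').symm 1 δ).2)
      (by
        have := (hy6 j k (Finset.ne_of_mem_erase hk').symm (-1) (-δ)).2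
        simp only [sgn, Units.val_neg, Units.val_one, Int.cast_neg, Int.cast_one] at this
        convert this using 2
        ring)
  have hV1 : V c g lam β 1 j x = (∏ ν, c.s (x j - I * g ν * β)) /
      (c.s (2 * x j) * c.s (2 * x j - I * β)) *
      ∏ k ∈ Finset.univ.erase j, ∏ δ : ℤˣ,
        c.s (x j + sgn δ * x k - I * lam * β) / c.s (x j + sgn δ * x k) := by
    rw [V, Finset.prod_comm]
    simp [sgn]
  have hVm : V c g lam β (-1) j y = (∏ ν, c.s (-y j - I * g ν * β)) /
      (c.s (-(2 * y j)) * c.s (-(2 * y j) - I * β)) *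
      ∏ k ∈ Finset.univ.erase j, ∏ δ : ℤˣ,
        c.s (y j + sgn δ * y k + I * lam * β) / c.s (y j + sgn δ * y k) := by
    rw [V, Finset.prod_comm]
    simp [sgn]
  constructor
  · rw [hV1]
    refine mul_ne_zero (div_ne_zero one.1 (mul_ne_zero (hx1 j) ?_))
      (Finset.prod_ne_zero_iff.2 fun k hk' => Finset.prod_ne_zero_iff.2 fun δ _ =>
        div_ne_zero (two k hk' δ).1 (hx3 j k (Finset.ne_of_mem_erase hk').symm δ))
    simpa [sgn, sub_eq_add_neg] using hx2 j (-1)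
  · have h1 : (∏ k ∈ Finset.univ.erase j, ∏ δ : ℤˣ,
          c.s (y j + sgn δ * y k + I * lam * β) / c.s (y j + sgn δ * y k)) *
        (∏ k ∈ Finset.univ.erase j, twoParticle lam β G (y j) (y k)) =
        (∏ k ∈ Finset.univ.erase j, ∏ δ : ℤˣ,
          c.s (x j + sgn δ * x k - I * lam * β) / c.s (x j + sgn δ * x k)) *
        (∏ k ∈ Finset.univ.erase j, twoParticle lam β G (x j) (x k)) := by
      rw [← Finset.prod_mul_distrib, ← Finset.prod_mul_distrib]
      refine Finset.prod_congr rfl fun k hk' => ?_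
      rw [twoParticle_eq, twoParticle_eq, ← Finset.prod_mul_distrib, ← Finset.prod_mul_distrib]
      exact Finset.prod_congr rfl fun δ _ => (two k hk' δ).2
    have h2 : (∏ k ∈ Finset.univ.erase j, oneParticle g β G (y k)) =
        ∏ k ∈ Finset.univ.erase j, oneParticle g β G (x k) :=
      Finset.prod_congr rfl fun k hk' => by rw [hk k (Finset.ne_of_mem_erase hk')]
    have h3 : ∏ a ∈ Finset.univ.erase j, ∏ b ∈ (Finset.Ioi a).erase j,
        twoParticle lam β G (y a) (y b) = ∏ a ∈ Finset.univ.erase j, ∏ b ∈ (Finset.Ioi a).erase j,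
        twoParticle lam β G (x a) (x b) :=
      Finset.prod_congr rfl fun a ha => Finset.prod_congr rfl fun b hb => by
        rw [hk a (Finset.ne_of_mem_erase ha), hk b (Finset.ne_of_mem_erase hb)]
    rw [groundStateSq_eq g lam β y j, groundStateSq_eq g lam β x j, hV1, hVm, h2, h3]
    linear_combination (((∏ k ∈ Finset.univ.erase j, oneParticle g β G (x k)) *
      ∏ a ∈ Finset.univ.erase j, ∏ b ∈ (Finset.Ioi a).erase j,
        twoParticle lam β G (x a) (x b))) * (one.2 * ((∏ k ∈ Finset.univ.erase j, ∏ δ : ℤˣ,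
          c.s (y j + sgn δ * y k + I * lam * β) / c.s (y j + sgn δ * y k)) *
        (∏ k ∈ Finset.univ.erase j, twoParticle lam β G (y j) (y k))) +
        (∏ ν, c.s (x j - I * g ν * β)) / (c.s (2 * x j) * c.s (2 * x j - I * β)) *
        oneParticle g β G (x j) * h1)

end GroundState

/-! ### Coordinate shifts and the main theorem -/

theorem shift_self {N : ℕ} (x : Fin N → ℂ) (j : Fin N) (t : ℂ) : shift x j t j = x j + t := by
  simp [shift]

theorem shift_of_ne {N : ℕ} (x : Fin N → ℂ) {j k : Fin N} (h : k ≠ j) (t : ℂ) :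
    shift x j t k = x k := by
  simp [shift, h]

theorem shift_shift_cancel {N : ℕ} (x : Fin N → ℂ) (j : Fin N) {s t : ℂ} (h : s + t = 0) :
    shift (shift x j s) j t = x := by
  ext k
  by_cases hk : k = j
  · subst hk
    rw [shift_self, shift_self, add_assoc, h, add_zero]
  · rw [shift_of_ne _ hk, shift_of_ne _ hk]

theorem analyticAt_shift {N : ℕ} (j : Fin N) (t : ℂ) (y : Fin N → ℂ) :
    AnalyticAt ℂ (fun y => shift y j t) y := by
  have : (fun y : Fin N → ℂ => shift y j t) = fun y => y + Pi.single j t := by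
    ext y k
    by_cases hk : k = j
    · subst hk
      simp [shift_self]
    · simp [shift_of_ne _ hk, hk]
  rw [this]
  exact analyticAt_id.add analyticAt_const

end VanDiejen

theorem mainTheorem8
    (c : SCase) (hc : c.Positive) (N : ℕ) (g : Fin (2 * c.rho + 2) → ℝ) (lam β : ℝ) (hβ : 0 < β)
    -- no nonzero integer multiple of `iβ` is a period
    (hper : ∀ k : ℤ, k ≠ 0 → (k : ℂ) * (I * β) ∉ c.Omega)
    -- the constant denominators in `V⁰` and `c⁰` do not vanish
    (hlam : ∀ ν ≤ c.rho, ∀ μ ≤ c.rho, c.s ((c.omega ν - c.omega μ + I * (lam - 1) * β) / 2) ≠ 0)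
    -- the balancing condition in the elliptic case
    (hbal : ∀ r a : ℝ, c = .elliptic r a → 2 * lam * ((N : ℝ) - 1) + ∑ ν, g ν - 2 = 0)
    -- the Gamma function: the explicit one, or any other solution of its functional equation
    (G : ℂ → ℂ) (hG : G = c.G β ∨ c.IsGammaFunction β G)
    -- any branch `Ψ` of the ground state, any branches `Rplus j` of the roots of the `V_j^+`
    (Ψ : (Fin N → ℂ) → ℂ) (hΨ : ∀ x, Ψ x ^ 2 = groundStateSq c g lam β G x)
    (Rplus : Fin N → (Fin N → ℂ) → ℂ) (hRplus : ∀ j x, Rplus j x ^ 2 = V c g lam β 1 j x) :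
    ∃ R : ℤˣ → Fin N → (Fin N → ℂ) → ℂ,
      R 1 = Rplus ∧
      (∀ ε j x, R ε j x ^ 2 = V c g lam β ε j x) ∧
      -- the roots of the `V_j^-` are holomorphic where the given branches are
      (∀ j, ∀ y ∈ interior {y | IsRegular c g lam β G y ∧
            IsRegular c g lam β G (shift y j (I * β))},
          AnalyticAt ℂ Ψ y → AnalyticAt ℂ Ψ (shift y j (I * β)) →
          AnalyticAt ℂ (Rplus j) (shift y j (I * β)) → AnalyticAt ℂ (R (-1) j) y) ∧
      -- the eigenvalue equation
      (∀ x, IsRegular c g lam β G x →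
          (∀ j, ∀ ε : ℤˣ, IsRegular c g lam β G (shift x j (sgn ε * I * β))) →
          H c g lam β R Ψ x = eigenvalue c g lam β N * Ψ x) := by
  classical
  have hGL := isGammaLike hc hβ hG
  let D : Fin N → (Fin N → ℂ) → Prop := fun j y =>
    IsRegular c g lam β G y ∧ IsRegular c g lam β G (shift y j (I * β))
  -- By detailed balance this squares to V_j^-(y), and it is the value for which the shift terms
  -- acting on Ψ lose their roots.
  let F : Fin N → (Fin N → ℂ) → ℂ := fun j y =>
    V c g lam β 1 j (shift y j (I * β)) * Ψ (shift y j (I * β)) /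
      (Rplus j (shift y j (I * β)) * Ψ y)
  have hkey : ∀ j y, D j y → V c g lam β 1 j (shift y j (I * β)) ≠ 0 ∧
      V c g lam β (-1) j y * groundStateSq c g lam β G y =
        V c g lam β 1 j (shift y j (I * β)) * groundStateSq c g lam β G (shift y j (I * β)) :=
    fun j y h => V_mul_groundStateSq hc g lam β hGL (shift_self y j _)
      (fun k hk => shift_of_ne y hk _) h.2 h.1
  have hΨ0 : ∀ y, IsRegular c g lam β G y → Ψ y ≠ 0 := fun y hy h => by
    have := hΨ y
    rw [h, zero_pow two_ne_zero] at this
    exact groundStateSq_ne_zero g lam β hy this.symm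
  have hR0 : ∀ j y, D j y → Rplus j (shift y j (I * β)) ≠ 0 := fun j y hy h => by
    have := hRplus j (shift y j (I * β))
    rw [h, zero_pow two_ne_zero] at this
    exact (hkey j y hy).1 this.symm
  -- Outside the set where y and y + iβ e_j are both regular, any root of V_j^- will do; the power
  -- 1/2 is taken.
  let R : ℤˣ → Fin N → (Fin N → ℂ) → ℂ := fun ε j y =>
    if ε = 1 then Rplus j y else if D j y then F j y else V c g lam β (-1) j y ^ ((2 : ℕ) : ℂ)⁻¹
  have hR1 : ∀ j y, R 1 j y = Rplus j y := fun j y => if_pos rfl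
  have hRm : ∀ j y, R (-1) j y =
      if D j y then F j y else V c g lam β (-1) j y ^ ((2 : ℕ) : ℂ)⁻¹ := fun j y =>
    if_neg (by decide)
  refine ⟨R, by ext; exact hR1 _ _, ?_, ?_, ?_⟩
  · intro ε j x
    rcases Int.units_eq_one_or ε with rfl | rfl
    · rw [hR1, hRplus]
    · rw [hRm]
      split_ifs with h
      · obtain ⟨h1, h2⟩ := hkey j x h
        have h3 := groundStateSq_ne_zero g lam β h.1
        simp only [F]
        rw [div_pow, mul_pow, mul_pow, hΨ, hΨ, hRplus, div_eq_iff (mul_ne_zero h1 h3)]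
        linear_combination -V c g lam β 1 j (shift x j (I * β)) * h2
      · exact cpow_nat_inv_pow _ two_ne_zero
  · intro j y hy hΨy hΨy' hRy
    have hy' : ∀ᶠ z in 𝓝 y, D j z := mem_interior_iff_mem_nhds.1 hy
    have hD := hy'.self_of_nhds
    have hsh := analyticAt_shift j (I * β) y
    obtain ⟨h1, h2, h3, -⟩ := hD.2
    have hV := analyticAt_V hc g lam β h1 h2 h3 1 j
    have hF : AnalyticAt ℂ (F j) y := by
      refine AnalyticAt.div (AnalyticAt.mul ?_ ?_) (AnalyticAt.mul ?_ hΨy)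
        (mul_ne_zero (hR0 j y hD) (hΨ0 y hD.1))
      · exact AnalyticAt.fun_comp hV hsh
      · exact AnalyticAt.fun_comp hΨy' hsh
      · exact AnalyticAt.fun_comp hRy hsh
    refine hF.congr ?_
    filter_upwards [hy'] with z hz
    rw [hRm, if_pos hz]
  · intro x hx hxs
    -- For ε = 1 the chosen root cancels R_j^+ and the shifted Ψ outright. For ε = -1 the term is
    -- V_j^+Ψ² at x + iβ e_j divided by Ψ(x), and detailed balance is needed again.
    have hterm : ∀ (ε : ℤˣ) (j : Fin N), R ε j x * (R (-ε) j (shift x j (-(sgn ε * I * β))) *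
        Ψ (shift x j (-(sgn ε * I * β)))) = V c g lam β ε j x * Ψ x := by
      intro ε j
      rcases Int.units_eq_one_or ε with rfl | rfl
      · have e1 : shift (shift x j (-(sgn 1 * I * β))) j (I * β) = x :=
          shift_shift_cancel x j (by simp [sgn])
        have hD : D j (shift x j (-(sgn 1 * I * β))) := by
          refine ⟨?_, by rwa [e1]⟩
          have := hxs j (-1)
          simpa [sgn] using this
        have h1 := hR0 j _ hD
        have h2 := hΨ0 _ hD.1
        rw [hR1, hRm, if_pos hD]
        simp only [F]
        rw [e1] at h1 ⊢
        field_simp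
      · have e1 : -(sgn (-1) * I * β) = I * β := by simp [sgn]
        have hD : D j x := ⟨hx, by simpa [sgn] using hxs j 1⟩
        have h1 := hR0 j _ hD
        have h2 := hΨ0 _ hx
        rw [e1, neg_neg, hR1, hRm, if_pos hD]
        simp only [F]
        have h3 := (hkey j x hD).2
        rw [← hΨ, ← hΨ] at h3
        field_simp
        linear_combination -h3
    rw [H, Finset.sum_congr rfl fun ε _ => Finset.sum_congr rfl fun j _ => hterm ε j]
    simp only [← Finset.sum_mul]
    rw [← sum_V_add_V0 hc g lam β hlam hbal x hx.1 hx.2.1 hx.2.2.1]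
    ring
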